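/- Let $d\ge 2$ and let ${\bf X}=({\bf x}_1,\dots,{\bf x}_N)$ be pairwise distinct points of ${\mathbb R}^d$. A loading is a family of forces ${\bf F}=({\bf f}_1,\dots,{\bf f}_N)\in({\mathbb R}^d)^N$, with ${\bf f}_i$ applied at ${\bf x}_i$. Put $${\cal A}_{\bf X}=\{{\bf U}\in({\mathbb R}^d)^N:\ ({\bf u}_i-{\bf u}_j)\cdot({\bf x}_i-{\bf x}_j)\ge 0\ \text{ for all } 1\le i<j\le N\},$$ and let ${\cal A}^*_{\bf X}=\{{\bf F}:\ \sum_i {\bf f}_i\cdot{\bf u}_i\ge 0 \text{ for all } {\bf U}\in{\cal A}_{\bf X}\}$ be its dual cone, the admissible loading cone. It is contained in the space of balanced loadings $${\cal B}_{\bf X}=\Big\{{\bf F}:\ \sum_{i}{\bf f}_i=0,\ \sum_{i}({\bf f}_i\otimes{\bf x}_i-{\bf x}_i\otimes{\bf f}_i)=0\Big\},$$ and its interior is understood relative to ${\cal B}_{\bf X}$. A finite web $W$ with terminal nodes ${\bf X}$ consists of finitely many distinct points of ${\mathbb R}^d$ (nodes), among them ${\bf x}_1,\dots,{\bf x}_N$,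 and of finitely many bars, each a segment joining two different nodes. The web $W$ supports ${\bf F}$ at ${\bf X}$ if one can assign to each bar $[{\bf p},{\bf q}]$ a tension $\sigma_{{\bf p}{\bf q}}\ge 0$ so that, at each node ${\bf p}$, the sum of $\sigma_{{\bf p}{\bf q}}\,({\bf q}-{\bf p})/\|{\bf q}-{\bf p}\|$ over the bars $[{\bf p},{\bf q}]$ ending at ${\bf p}$, plus the applied force (${\bf f}_i$ if ${\bf p}={\bf x}_i$, and $0$ at the other nodes), vanishes. Let ${\cal C}^W_{\bf X}$ be the set of all loadings that $W$ supports at ${\bf X}$. **Theorem (existence of uniloadable webs).** For any ${\bf F}$ in the interior of ${\cal A}^*_{\bf X}$ relative to ${\cal B}_{\bf X}$, there exists a finite web $W$ with terminal nodes ${\bf X}$ such that ${\cal C}^W_{\bf X}=\{\lambda{\bf F}:\ \lambda\ge 0\}$. -/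

import Mathlib

/-- Points, forces and displacements live in `ℝ^d` with its Euclidean structure. -/
abbrev Vec (d : ℕ) : Type := EuclideanSpace ℝ (Fin d)

/-- The space `B_X` of balanced loadings at the points `X`: the forces `f_i` with zero resultant
`∑ f_i = 0` and zero total moment `∑ (f_i ⊗ x_i - x_i ⊗ f_i) = 0`. -/
def balancedLoadings {d N : ℕ} (X : Fin N → Vec d) : Submodule ℝ (Fin N → Vec d) where
  carrier := {F | ∑ i, F i = 0 ∧ ∀ a b : Fin d, ∑ i, (F i a * X i b - X i a * F i b) = 0}
  zero_mem' := by simp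
  add_mem' := by
    rintro F G ⟨hF, hF'⟩ ⟨hG, hG'⟩
    refine ⟨by simp [Finset.sum_add_distrib, hF, hG], fun a b => ?_⟩
    have h : ∑ i, ((F + G) i a * X i b - X i a * (F + G) i b)
        = ∑ i, (F i a * X i b - X i a * F i b) + ∑ i, (G i a * X i b - X i a * G i b) := by
      rw [← Finset.sum_add_distrib]
      refine Finset.sum_congr rfl fun i _ => ?_
      simp only [Pi.add_apply, PiLp.add_apply]
      ring
    rw [h, hF' a b, hG' a b, add_zero]
  smul_mem' := by
    rintro c F ⟨hF, hF'⟩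
    refine ⟨by simp [← Finset.smul_sum, hF], fun a b => ?_⟩
    have h : ∑ i, ((c • F) i a * X i b - X i a * (c • F) i b)
        = c * ∑ i, (F i a * X i b - X i a * F i b) := by
      rw [Finset.mul_sum]
      refine Finset.sum_congr rfl fun i _ => ?_
      simp only [Pi.smul_apply, PiLp.smul_apply, smul_eq_mul]
      ring
    rw [h, hF' a b, mul_zero]

/-- The cone `A_X` of admissible displacements: `(u_i - u_j) · (x_i - x_j) ≥ 0` for all `i < j`. -/
def admissibleDisplacements {d N : ℕ} (X : Fin N → Vec d) : Set (Fin N → Vec d) :=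
  {U | ∀ i j, i < j → 0 ≤ inner ℝ (U i - U j) (X i - X j)}

/-- The admissible loading cone `A_X^*`, the dual cone of `A_X`: the loadings `F` with
`F · U = ∑ f_i · u_i ≥ 0` for every `U ∈ A_X`. -/
def admissibleLoadingCone {d N : ℕ} (X : Fin N → Vec d) : Set (Fin N → Vec d) :=
  {F | ∀ U ∈ admissibleDisplacements X, 0 ≤ ∑ i, inner ℝ (F i) (U i)}

/-- The interior of the admissible loading cone relative to the subspace `B_X` of balanced
loadings (which contains the cone). -/
def interiorAdmissibleLoadingCone {d N : ℕ} (X : Fin N → Vec d) : Set (Fin N → Vec d) :=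
  Subtype.val '' interior {F : balancedLoadings X | (F : Fin N → Vec d) ∈ admissibleLoadingCone X}

/-- A finite web with terminal nodes `X`: finitely many further (internal) nodes, and a finite
collection of bars, each being a segment joining two different nodes. All nodes are distinct
points. Bars are allowed to cross or overlap away from their end points. -/
structure FiniteWeb {d N : ℕ} (X : Fin N → Vec d) where
  /-- the number of internal nodes -/
  numInternal : ℕ
  /-- the positions of the internal nodes -/
  internalNode : Fin numInternal → Vec d
  /-- terminal and internal nodes are pairwise distinct points -/
  node_injective : Function.Injective (Sum.elim X internalNode)
  /-- the pairs of nodes that are joined by a bar -/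
  bars : SimpleGraph (Fin N ⊕ Fin numInternal)

namespace FiniteWeb

variable {d N : ℕ} {X : Fin N → Vec d}

/-- The position of a node (terminal or internal). -/
def node (W : FiniteWeb X) : Fin N ⊕ Fin W.numInternal → Vec d :=
  Sum.elim X W.internalNode

open Classical in
/-- The total force that the bars exert on the node `v` when the bar `[p, q]` carries the tension
`σ s(p, q)`: each bar `[v, w]` pulls `v` towards `w`. -/
noncomputable def barForce (W : FiniteWeb X) (σ : Sym2 (Fin N ⊕ Fin W.numInternal) → ℝ)
    (v : Fin N ⊕ Fin W.numInternal) : Vec d :=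
  ∑ w with W.bars.Adj v w,
    (σ s(v, w) / ‖W.node w - W.node v‖) • (W.node w - W.node v)

/-- `σ` is an admissible stress state on `W` for the loading `F` at `X`: all tensions are
nonnegative, and every node is in equilibrium under the tensions of the bars ending there and the
applied force (`F i` at the `i`-th terminal node, none at an internal node). Only the values of
`σ` on bars matter. -/
structure IsAdmissibleStress (W : FiniteWeb X) (F : Fin N → Vec d)
    (σ : Sym2 (Fin N ⊕ Fin W.numInternal) → ℝ) : Prop where
  tension_nonneg : ∀ e ∈ W.bars.edgeSet, 0 ≤ σ e
  terminal_equilibrium : ∀ i : Fin N, F i + W.barForce σ (Sum.inl i) = 0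
  internal_equilibrium : ∀ k : Fin W.numInternal, W.barForce σ (Sum.inr k) = 0

/-- The cone `C^W_X` of all loadings that the web `W` supports at `X`. -/
def supportedLoadings (W : FiniteWeb X) : Set (Fin N → Vec d) :=
  {F | ∃ σ, W.IsAdmissibleStress F σ}

end FiniteWeb

/-! By duality, a loading in the relative interior is a combination of all pair loadings with
positive densities (`exists_pos_densities`): the complete graph on the terminals supports it. That
graph supports many other loadings too, since its bars can be loaded independently. The remedy is to
tie all bars together by a slightly stressed string.

Choose a point `a m` inside each segment `[u m, v m]` joining two terminals, and a string `X α, P 0,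
…, P n = X β` whose node `P m` is in equilibrium between its two neighbours and a pull towards `a m`
(`exists_isString`). If the pulls are transferred to the ends of the segments, the string carries a
balanced loading (`stringLoading_mem_balanced`). Pair loadings span the balanced loadings, so this
loading, scaled by a small `ε`, is compensated by altering the densities `s m` to `s m - ε * r m`,
which stay positive. The straight bar `[u m, v m]` is then replaced by two bars meeting at a node `q
m`, displaced from `a m` towards `P m` so as to balance the pull of the string.

Each internal node now has exactly three bars, two of them not parallel, so its equilibrium fixes
their tensions up to one factor (`three_bars_rigid`). Every bar touches an internal node and the
internal nodes are connected, so all these factors agree and only one ray is supported. General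
position is available because the span of the pair loadings forces three or more terminals to be
noncollinear (`exists_not_mem_line`). -/

/-! ### Pair loadings and duality -/

/-- The loading exerted by a unit force density in the bar joining two terminals. -/
noncomputable def pairLoading {d N : ℕ} (X : Fin N → Vec d) (p : Fin N × Fin N) : Fin N → Vec d :=
  Pi.single p.1 (X p.1 - X p.2) + Pi.single p.2 (X p.2 - X p.1)

theorem sum_inner_pairLoading {d N : ℕ} (X U : Fin N → Vec d) (p : Fin N × Fin N) :
    ∑ i, inner ℝ (pairLoading X p i) (U i) = inner ℝ (U p.1 - U p.2) (X p.1 - X p.2) := by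
  have h : ∀ (k : Fin N) (v : Vec d),
      ∑ i, inner ℝ ((Pi.single k v : Fin N → Vec d) i) (U i) = inner ℝ v (U k) := by
    intro k v
    rw [Finset.sum_eq_single k]
    · simp
    · intro b _ hb; simp [Pi.single_eq_of_ne hb]
    · simp
  simp only [pairLoading, Pi.add_apply, inner_add_left, Finset.sum_add_distrib, h]
  rw [← neg_sub (X p.1) (X p.2), inner_neg_left, inner_sub_left (U p.1),
    real_inner_comm (U p.1), real_inner_comm (U p.2)]
  ring

theorem pairLoading_mem_balanced {d N : ℕ} (X : Fin N → Vec d) (p : Fin N × Fin N) :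
    pairLoading X p ∈ balancedLoadings X := by
  refine ⟨by simp [pairLoading, Finset.sum_add_distrib], fun a b => ?_⟩
  have h : ∀ (k : Fin N) (v : Vec d),
      ∑ i, ((Pi.single k v : Fin N → Vec d) i a * X i b - X i a * (Pi.single k v : Fin N → Vec d) i b)
        = v a * X k b - X k a * v b := by
    intro k v
    rw [Finset.sum_eq_single k]
    · simp
    · intro c _ hc; simp [Pi.single_eq_of_ne hc]
    · simp
  have : ∀ i, pairLoading X p i a * X i b - X i a * pairLoading X p i b
      = ((Pi.single p.1 (X p.1 - X p.2) : Fin N → Vec d) i a * X i b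
          - X i a * (Pi.single p.1 (X p.1 - X p.2) : Fin N → Vec d) i b)
        + ((Pi.single p.2 (X p.2 - X p.1) : Fin N → Vec d) i a * X i b
          - X i a * (Pi.single p.2 (X p.2 - X p.1) : Fin N → Vec d) i b) := by
    intro i
    simp only [pairLoading, Pi.add_apply, PiLp.add_apply]
    ring
  rw [Finset.sum_congr rfl fun i _ => this i, Finset.sum_add_distrib, h, h]
  simp only [PiLp.sub_apply]
  ring

/-- Every linear functional on loadings is the work in some displacement. -/
theorem exists_displacement {d N : ℕ} (g : (Fin N → Vec d) →ₗ[ℝ] ℝ) :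
    ∃ U : Fin N → Vec d, ∀ G, g G = ∑ i, inner ℝ (G i) (U i) := by
  refine ⟨fun i => (InnerProductSpace.toDual ℝ (Vec d)).symm
    (LinearMap.toContinuousLinearMap (g ∘ₗ LinearMap.single ℝ (fun _ => Vec d) i)), fun G => ?_⟩
  conv_lhs => rw [← Finset.univ_sum_single G, map_sum]
  refine Finset.sum_congr rfl fun i _ => ?_
  rw [real_inner_comm, InnerProductSpace.toDual_symm_apply]
  simp

/-- The index set of pairs of terminals. -/
abbrev TerminalPair (N : ℕ) : Type := {p : Fin N × Fin N // p.1 < p.2}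

/-- The balanced loading produced by given force densities in all the pairs of terminals. -/
noncomputable def densityLoading {d N : ℕ} (X : Fin N → Vec d) :
    (TerminalPair N → ℝ) →ₗ[ℝ] balancedLoadings X :=
  Fintype.linearCombination ℝ fun p : TerminalPair N =>
    (⟨pairLoading X p.1, pairLoading_mem_balanced X p.1⟩ : balancedLoadings X)

theorem densityLoading_coe {d N : ℕ} (X : Fin N → Vec d) (s : TerminalPair N → ℝ) :
    (densityLoading X s : Fin N → Vec d) = ∑ p, s p • pairLoading X p.1 := by
  simp [densityLoading, Fintype.linearCombination_apply]

theorem densityLoading_single {d N : ℕ} (X : Fin N → Vec d) (p : TerminalPair N) :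
    (densityLoading X (Pi.single p 1) : Fin N → Vec d) = pairLoading X p.1 := by
  rw [densityLoading_coe, Finset.sum_eq_single p]
  · simp
  · intro b _ hb; simp [Pi.single_eq_of_ne hb]
  · simp

theorem mem_admissibleDisplacements_of_pairs {d N : ℕ} {X U : Fin N → Vec d}
    (h : ∀ p : TerminalPair N, 0 ≤ ∑ i, inner ℝ (pairLoading X p.1 i) (U i)) :
    U ∈ admissibleDisplacements X := by
  intro i j hij
  have := h ⟨(i, j), hij⟩
  rwa [sum_inner_pairLoading] at this

theorem exists_pos_add_smul_mem {d N : ℕ} {X : Fin N → Vec d} {F : balancedLoadings X}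
    (hF : F ∈ interior {F : balancedLoadings X | (F : Fin N → Vec d) ∈ admissibleLoadingCone X})
    (G : balancedLoadings X) :
    ∃ δ : ℝ, 0 < δ ∧ ((F + δ • G : balancedLoadings X) : Fin N → Vec d) ∈ admissibleLoadingCone X := by
  have hc : Filter.Tendsto (fun t : ℝ => F + t • G) (nhdsWithin 0 (Set.Ioi 0)) (nhds F) := by
    have : Continuous (fun t : ℝ => F + t • G) := by fun_prop
    have h := this.tendsto 0
    simp only [zero_smul, add_zero] at h
    exact h.mono_left nhdsWithin_le_nhds
  have h1 := hc.eventually (mem_interior_iff_mem_nhds.1 hF)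
  obtain ⟨t, ht, ht'⟩ := (h1.and self_mem_nhdsWithin).exists
  exact ⟨t, ht', ht⟩

/-- A functional killing all pair loadings is the work in a displacement `U` with both `U` and `-U`
admissible. It thus vanishes on the admissible cone, and on all balanced loadings because the cone
has a relative interior point. -/
theorem densityLoading_surjective {d N : ℕ} {X : Fin N → Vec d} {F : balancedLoadings X}
    (hF : F ∈ interior {F : balancedLoadings X | (F : Fin N → Vec d) ∈ admissibleLoadingCone X}) :
    Function.Surjective (densityLoading X) := by
  rw [← LinearMap.range_eq_top]
  by_contra hne
  obtain ⟨f, hf0, hf⟩ := Submodule.exists_le_ker_of_lt_top _ (lt_top_iff_ne_top.2 hne)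
  obtain ⟨g, hg⟩ := LinearMap.exists_extend f
  obtain ⟨U, hU⟩ := exists_displacement g
  have hfg : ∀ G : balancedLoadings X, f G = ∑ i, inner ℝ ((G : Fin N → Vec d) i) (U i) := by
    intro G; rw [← hU, ← hg]; rfl
  have hzero : ∀ p : TerminalPair N, ∑ i, inner ℝ (pairLoading X p.1 i) (U i) = 0 := by
    intro p
    rw [← densityLoading_single X p, ← hfg]
    exact hf ⟨_, rfl⟩
  have hUA : U ∈ admissibleDisplacements X :=
    mem_admissibleDisplacements_of_pairs fun p => (hzero p).ge
  have hUA' : -U ∈ admissibleDisplacements X :=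
    mem_admissibleDisplacements_of_pairs fun p => by simp [hzero p]
  apply hf0
  have key : ∀ G ∈ {F : balancedLoadings X | (F : Fin N → Vec d) ∈ admissibleLoadingCone X},
      f G = 0 := by
    intro G hG
    refine le_antisymm ?_ (by rw [hfg]; exact hG U hUA)
    have := hG (-U) hUA'
    rw [hfg]
    simpa using this
  ext G
  obtain ⟨δ, hδ, hm⟩ := exists_pos_add_smul_mem hF G
  have h1 := key _ hm
  rw [map_add, key F (interior_subset hF), map_smul, zero_add, smul_eq_mul] at h1
  simpa [hδ.ne'] using h1

/-- A loading in the relative interior of the admissible cone is supported by positive force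
densities in all the pairs of terminals. -/
theorem exists_pos_densities {d N : ℕ} {X : Fin N → Vec d} {F : balancedLoadings X}
    (hF : F ∈ interior {F : balancedLoadings X | (F : Fin N → Vec d) ∈ admissibleLoadingCone X}) :
    ∃ s : TerminalPair N → ℝ, (∀ p, 0 < s p) ∧ densityLoading X s = F := by
  by_contra hno
  have hsurj := densityLoading_surjective hF
  set O : Set (TerminalPair N → ℝ) := Set.univ.pi fun _ => Set.Ioi 0 with hO
  have hOo : IsOpen O := isOpen_set_pi Set.finite_univ fun _ _ => isOpen_Ioi
  have hOc : Convex ℝ O := convex_pi fun _ _ => convex_Ioi 0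
  have hPo : IsOpen (densityLoading X '' O) :=
    LinearMap.isOpenMap_of_finiteDimensional _ hsurj _ hOo
  have hPc : Convex ℝ (densityLoading X '' O) := hOc.linear_image _
  have hFP : F ∉ densityLoading X '' O := by
    rintro ⟨s, hs, h⟩
    exact hno ⟨s, fun p => hs p trivial, h⟩
  obtain ⟨f, hf⟩ := geometric_hahn_banach_point_open hPc hPo hFP
  obtain ⟨g, hg⟩ := LinearMap.exists_extend (f : balancedLoadings X →ₗ[ℝ] ℝ)
  obtain ⟨U, hU⟩ := exists_displacement g
  have hfg : ∀ G : balancedLoadings X, f G = ∑ i, inner ℝ ((G : Fin N → Vec d) i) (U i) := by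
    intro G; rw [← hU]; exact (LinearMap.congr_fun hg G).symm
  have hpos : ∀ s : TerminalPair N → ℝ, (∀ p, 0 < s p) → f F < f (densityLoading X s) :=
    fun s hs => hf _ ⟨s, fun p _ => hs p, rfl⟩
  have hUA : U ∈ admissibleDisplacements X := by
    refine mem_admissibleDisplacements_of_pairs fun p => ?_
    rw [← densityLoading_single X p, ← hfg]
    by_contra hneg
    push Not at hneg
    set c := f (densityLoading X (Pi.single p 1)) with hc
    set b := f (densityLoading X fun _ => 1) with hb
    have h1 : f F < b := hpos _ fun _ => one_pos
    -- This weight brings the value of `f` down to exactly `f F`, against the strict separation.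
    have h2 := hpos ((fun _ => 1) + ((b - f F) / (-c)) • Pi.single p 1) fun q => by
      have : 0 ≤ (b - f F) / (-c) := div_nonneg (by linarith) (by linarith)
      have h3 : (0 : ℝ) ≤ (Pi.single p 1 : TerminalPair N → ℝ) q := by
        by_cases hq : q = p
        · subst hq; simp
        · simp [Pi.single_eq_of_ne hq]
      simp only [Pi.add_apply, Pi.smul_apply, smul_eq_mul]
      positivity
    rw [map_add, map_smul, map_add, map_smul, ← hc, ← hb, smul_eq_mul] at h2
    have hc0 : c ≠ 0 := hneg.ne
    have : (b - f F) / (-c) * c = -(b - f F) := by field_simp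
    linarith
  -- Interiority leaves room to subtract a small multiple of the all-ones loading. Testing the
  -- difference against `U` contradicts the separation.
  obtain ⟨δ, hδ, hm⟩ := exists_pos_add_smul_mem hF (-densityLoading X fun _ => 1)
  have h1 := hm U hUA
  rw [← hfg, map_add, map_smul, map_neg, smul_eq_mul] at h1
  have h2 := hpos (δ • fun _ => 1) fun p => by simpa using hδ
  rw [map_smul, map_smul, smul_eq_mul] at h2
  linarith

/-- If pair loadings span the balanced loadings of at least three points, these are not collinear. -/
theorem exists_not_mem_line {d N : ℕ} (hd : 2 ≤ d) (hN : 3 ≤ N) {X : Fin N → Vec d}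
    (hX : Function.Injective X) (hsurj : Function.Surjective (densityLoading X))
    (y w : Vec d) : ∃ i, ∀ c : ℝ, X i - y ≠ c • w := by
  by_contra hno
  push Not at hno
  choose c hc using hno
  have hXc : ∀ i, X i = y + c i • w := fun i => by rw [← hc]; abel
  obtain ⟨v, hv0, hvw⟩ : ∃ v : Vec d, v ≠ 0 ∧ inner ℝ v w = 0 := by
    have hlt : Module.finrank ℝ (Submodule.span ℝ {w}) < Module.finrank ℝ (Vec d) := by
      have : Module.finrank ℝ (Submodule.span ℝ {w}) ≤ 1 := by
        simpa using finrank_span_le_card (R := ℝ) ({w} : Set (Vec d))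
      rw [finrank_euclideanSpace_fin]
      omega
    have : (Submodule.span ℝ {w})ᗮ ≠ ⊥ := by
      intro h
      rw [Submodule.orthogonal_eq_bot_iff] at h
      rw [h, finrank_top] at hlt
      exact lt_irrefl _ hlt
    obtain ⟨v, hv, hv0⟩ := Submodule.exists_mem_ne_zero_of_ne_bot this
    exact ⟨v, hv0, by
      rw [real_inner_comm]
      exact (Submodule.mem_orthogonal_singleton_iff_inner_right).1 hv⟩
  let i0 : Fin N := ⟨0, by omega⟩
  let i1 : Fin N := ⟨1, by omega⟩
  let i2 : Fin N := ⟨2, by omega⟩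
  have h01 : i0 ≠ i1 := by simp [i0, i1]
  have h02 : i0 ≠ i2 := by simp [i0, i2]
  have h12 : i1 ≠ i2 := by simp [i1, i2]
  have hcne : c i1 ≠ c i2 := fun h => h12 (hX (by rw [hXc i1, hXc i2, h]))
  -- Affine dependence of three collinear points: the forces `α i • v`, orthogonal to the line, have
  -- zero resultant and moment, whereas pair loadings act along the line.
  let α : Fin N → ℝ := Pi.single i0 (c i1 - c i2) + Pi.single i1 (c i2 - c i0)
    + Pi.single i2 (c i0 - c i1)
  have hα : ∀ f : Fin N → ℝ, ∑ i, α i * f i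
      = (c i1 - c i2) * f i0 + (c i2 - c i0) * f i1 + (c i0 - c i1) * f i2 := by
    intro f
    have h : ∀ (k : Fin N) (x : ℝ), ∑ i, (Pi.single k x : Fin N → ℝ) i * f i = x * f k := by
      intro k x
      rw [Finset.sum_eq_single k]
      · simp
      · intro b _ hb; simp [Pi.single_eq_of_ne hb]
      · simp
    simp only [α, Pi.add_apply, add_mul, Finset.sum_add_distrib, h]
  have hsum : ∑ i, α i = 0 := by
    have := hα fun _ => 1
    simp only [mul_one] at this
    rw [this]; ring
  have hmom : ∀ b : Fin d, ∑ i, α i * X i b = 0 := by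
    intro b
    rw [hα]
    simp only [hXc, PiLp.add_apply, PiLp.smul_apply, smul_eq_mul]
    ring
  let G : balancedLoadings X := ⟨fun i => α i • v, by
    refine ⟨by rw [← Finset.sum_smul, hsum, zero_smul], fun a b => ?_⟩
    have : ∀ i, (α i • v) a * X i b - X i a * (α i • v) b
        = v a * (α i * X i b) - v b * (α i * X i a) := by
      intro i
      simp only [PiLp.smul_apply, smul_eq_mul]
      ring
    rw [Finset.sum_congr rfl fun i _ => this i, Finset.sum_sub_distrib, ← Finset.mul_sum,
      ← Finset.mul_sum, hmom, hmom]
    simp⟩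
  obtain ⟨r, hr⟩ := hsurj G
  have hr' := congrArg (fun H : balancedLoadings X => (H : Fin N → Vec d)) hr
  simp only [densityLoading_coe] at hr'
  have h1 : ∑ i, inner ℝ ((G : Fin N → Vec d) i) ((Pi.single i0 v : Fin N → Vec d) i)
      = (c i1 - c i2) * inner ℝ v v := by
    rw [Finset.sum_eq_single i0]
    · simp [G, α, Pi.single_eq_of_ne h01, Pi.single_eq_of_ne h02, inner_smul_left]
    · intro b _ hb; simp [Pi.single_eq_of_ne hb]
    · simp
  have h2 : ∑ i, inner ℝ ((∑ p, r p • pairLoading X p.1) i) ((Pi.single i0 v : Fin N → Vec d) i)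
      = 0 := by
    simp only [Finset.sum_apply, Pi.smul_apply, sum_inner, inner_smul_left]
    rw [Finset.sum_comm]
    refine Finset.sum_eq_zero fun p _ => ?_
    rw [← Finset.mul_sum, sum_inner_pairLoading]
    have hpar : X p.1.1 - X p.1.2 = (c p.1.1 - c p.1.2) • w := by
      rw [hXc, hXc p.1.2, sub_smul]; abel
    have hs : ∀ k : Fin N, inner ℝ ((Pi.single i0 v : Fin N → Vec d) k) w = 0 := by
      intro k
      by_cases hk : k = i0
      · subst hk; simpa using hvw
      · simp [Pi.single_eq_of_ne hk]
    rw [hpar, inner_smul_right, inner_sub_left, hs, hs]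
    simp
  rw [hr'] at h2
  rw [h2] at h1
  rcases mul_eq_zero.1 h1.symm with h | h
  · exact hcne (sub_eq_zero.1 h)
  · exact hv0 (inner_self_eq_zero.1 h)

/-! ### From rigidity at each node to a single supported ray -/

/-- A positive stress state, given by force densities, in which every node is rigidly determined by
its own equilibrium and the internal nodes are connected, yields a web supporting one ray only. -/
theorem exists_uniloadable_web_fin {d N M : ℕ} (X : Fin N → Vec d) (F : Fin N → Vec d)
    (z : Fin M → Vec d) (hinj : Function.Injective (Sum.elim X z))
    (ω : Fin N ⊕ Fin M → Fin N ⊕ Fin M → ℝ) (hsymm : ∀ v w, ω v w = ω w v)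
    (hpos : ∀ v w, 0 ≤ ω v w) (hself : ∀ v, ω v v = 0)
    (hterm : ∀ i j, ω (Sum.inl i) (Sum.inl j) = 0)
    (hint : ∀ v, ∑ w, ω (Sum.inr v) w • (Sum.elim X z w - z v) = 0)
    (hF : ∀ i, F i + ∑ w, ω (Sum.inl i) w • (Sum.elim X z w - X i) = 0)
    (hloc : ∀ v, ∀ c : Fin N ⊕ Fin M → ℝ, (∀ w, ω (Sum.inr v) w = 0 → c w = 0) →
      ∑ w, c w • (Sum.elim X z w - z v) = 0 → ∃ k : ℝ, ∀ w, c w = k * ω (Sum.inr v) w)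
    (hconn : ∀ k : Fin M → ℝ, (∀ v w, ω (Sum.inr v) (Sum.inr w) ≠ 0 → k v = k w) →
      ∃ a, ∀ v, k v = a)
    (hne : ∃ v w, ω (Sum.inr v) w ≠ 0) :
    ∃ W : FiniteWeb X, W.supportedLoadings = {G | ∃ c : ℝ, 0 ≤ c ∧ G = c • F} := by
  classical
  let W : FiniteWeb X := ⟨M, z, hinj,
    { Adj := fun v w => ω v w ≠ 0
      symm := ⟨fun v w h => by rwa [hsymm]⟩
      loopless := ⟨fun v h => h (hself v)⟩ }⟩
  have hadj : ∀ v w, W.bars.Adj v w ↔ ω v w ≠ 0 := fun v w => Iff.rfl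
  have hforce : ∀ σ v, W.barForce σ v = ∑ w, (if ω v w ≠ 0 then
      σ s(v, w) / ‖Sum.elim X z w - Sum.elim X z v‖ else 0) •
        (Sum.elim X z w - Sum.elim X z v) := by
    intro σ v
    unfold FiniteWeb.barForce
    rw [Finset.sum_filter]
    refine Finset.sum_congr rfl fun w _ => ?_
    simp only [hadj, ite_smul, zero_smul]
    rfl
  refine ⟨W, Set.ext fun G => ⟨?_, ?_⟩⟩
  · rintro ⟨σ, hσ⟩
    set c : Fin N ⊕ Fin M → Fin N ⊕ Fin M → ℝ := fun v w => if ω v w ≠ 0 then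
      σ s(v, w) / ‖Sum.elim X z w - Sum.elim X z v‖ else 0 with hc
    have hcs : ∀ v w, c v w = c w v := by
      intro v w
      have hvw : (s(v, w) : Sym2 (Fin N ⊕ Fin M)) = s(w, v) := Sym2.eq_swap
      simp only [hc, hsymm v w, norm_sub_rev (Sum.elim X z w) (Sum.elim X z v)]
      rw [hvw]
    have hc0 : ∀ v w, ω v w = 0 → c v w = 0 := fun v w h => by simp [hc, h]
    have hcn : ∀ v w, 0 ≤ c v w := by
      intro v w
      by_cases h : ω v w = 0
      · exact (hc0 v w h).ge
      · simp only [hc, if_pos h]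
        exact div_nonneg (hσ.tension_nonneg _ ((SimpleGraph.mem_edgeSet _).2 h)) (norm_nonneg _)
    have h1 : ∀ v, ∃ k : ℝ, ∀ w, c (Sum.inr v) w = k * ω (Sum.inr v) w := by
      intro v
      refine hloc v _ (hc0 _) ?_
      have := hσ.internal_equilibrium v
      rwa [hforce] at this
    choose k hk using h1
    -- A bar has the same density seen from both ends, so the factors of its two internal nodes
    -- agree.
    obtain ⟨a, ha⟩ := hconn k fun v w h => by
      have h2 := hk v (Sum.inr w)
      rw [hcs, hk w, hsymm (Sum.inr w)] at h2
      exact (mul_right_cancel₀ h h2).symm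
    obtain ⟨v₀, w₀, h₀⟩ := hne
    have hp := lt_of_le_of_ne (hpos (Sum.inr v₀) w₀) (Ne.symm h₀)
    refine ⟨a, ?_, ?_⟩
    · have := hcn (Sum.inr v₀) w₀
      rw [hk, ha] at this
      exact nonneg_of_mul_nonneg_left this hp
    · funext i
      -- No bar joins two terminals, so the factor `a` of the internal nodes governs every bar at
      -- `i`.
      have h2 : ∀ w, c (Sum.inl i) w = a * ω (Sum.inl i) w := by
        rintro (j | v)
        · rw [hterm, hc0 _ _ (hterm i j), mul_zero]
        · rw [hcs, hk, ha, hsymm]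
      have h3 := hσ.terminal_equilibrium i
      rw [hforce] at h3
      change G i + ∑ w, c (Sum.inl i) w • (Sum.elim X z w - X i) = 0 at h3
      simp only [h2, mul_smul] at h3
      rw [← Finset.smul_sum] at h3
      rw [eq_neg_of_add_eq_zero_left h3, Pi.smul_apply, eq_neg_of_add_eq_zero_left (hF i), smul_neg]
  · rintro ⟨a, ha, rfl⟩
    let σ : Sym2 (Fin N ⊕ Fin M) → ℝ := Sym2.lift
      ⟨fun v w => a * ω v w * ‖Sum.elim X z w - Sum.elim X z v‖, fun v w => by
        simp only [hsymm v w, norm_sub_rev]⟩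
    have hσ : ∀ v w, (if ω v w ≠ 0 then
        σ s(v, w) / ‖Sum.elim X z w - Sum.elim X z v‖ else 0) = a * ω v w := by
      intro v w
      by_cases h : ω v w = 0
      · simp [h]
      · have hvw : v ≠ w := fun e => h (e ▸ hself v)
        have : ‖Sum.elim X z w - Sum.elim X z v‖ ≠ 0 :=
          norm_ne_zero_iff.2 (sub_ne_zero.2 fun e => hvw (hinj e).symm)
        simp only [ne_eq, h, not_false_eq_true, if_true, σ, Sym2.lift_mk]
        field_simp
    have hforce' : ∀ v, W.barForce σ v
        = a • ∑ w, ω v w • (Sum.elim X z w - Sum.elim X z v) := by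
      intro v
      rw [hforce, Finset.smul_sum]
      refine Finset.sum_congr rfl fun w _ => ?_
      rw [smul_smul, ← hσ v w]
    refine ⟨σ, ⟨?_, ?_, ?_⟩⟩
    · intro e _
      induction e using Sym2.ind with
      | _ v w => exact mul_nonneg (mul_nonneg ha (hpos _ _)) (norm_nonneg _)
    · intro i
      rw [hforce', Pi.smul_apply, ← smul_add]
      exact (congrArg (a • ·) (hF i)).trans (smul_zero a)
    · intro v
      rw [hforce']
      exact (congrArg (a • ·) (hint v)).trans (smul_zero a)

/-- Allows any finite index type for the internal nodes, so that linking nodes and string nodes can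
be kept apart in a sum type. -/
theorem exists_uniloadable_web {d N : ℕ} {V : Type} [Fintype V] (X : Fin N → Vec d)
    (F : Fin N → Vec d)
    (z : V → Vec d) (hinj : Function.Injective (Sum.elim X z))
    (ω : Fin N ⊕ V → Fin N ⊕ V → ℝ) (hsymm : ∀ v w, ω v w = ω w v)
    (hpos : ∀ v w, 0 ≤ ω v w) (hself : ∀ v, ω v v = 0)
    (hterm : ∀ i j, ω (Sum.inl i) (Sum.inl j) = 0)
    (hint : ∀ v, ∑ w, ω (Sum.inr v) w • (Sum.elim X z w - z v) = 0)
    (hF : ∀ i, F i + ∑ w, ω (Sum.inl i) w • (Sum.elim X z w - X i) = 0)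
    (hloc : ∀ v, ∀ c : Fin N ⊕ V → ℝ, (∀ w, ω (Sum.inr v) w = 0 → c w = 0) →
      ∑ w, c w • (Sum.elim X z w - z v) = 0 → ∃ k : ℝ, ∀ w, c w = k * ω (Sum.inr v) w)
    (hconn : ∀ k : V → ℝ, (∀ v w, ω (Sum.inr v) (Sum.inr w) ≠ 0 → k v = k w) →
      ∃ a, ∀ v, k v = a)
    (hne : ∃ v w, ω (Sum.inr v) w ≠ 0) :
    ∃ W : FiniteWeb X, W.supportedLoadings = {G | ∃ c : ℝ, 0 ≤ c ∧ G = c • F} := by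
  let e := Fintype.equivFin V
  let E : Fin N ⊕ Fin (Fintype.card V) ≃ Fin N ⊕ V := Equiv.sumCongr (Equiv.refl _) e.symm
  have hE : ∀ w, Sum.elim X (z ∘ e.symm) w = Sum.elim X z (E w) := by
    rintro (i | v) <;> rfl
  refine exists_uniloadable_web_fin X F (z ∘ e.symm) ?_ (fun v w => ω (E v) (E w))
    (fun _ _ => hsymm _ _) (fun _ _ => hpos _ _) (fun _ => hself _) (fun i j => hterm i j) ?_ ?_ ?_ ?_ ?_
  · intro v w h
    rw [hE, hE] at h
    exact E.injective (hinj h)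
  · intro v
    simp only [hE]
    exact (E.sum_comp fun w => ω (E (Sum.inr v)) w • (Sum.elim X z w - z (e.symm v))).trans
      (hint (e.symm v))
  · intro i
    simp only [hE]
    rw [E.sum_comp fun w => ω (E (Sum.inl i)) w • (Sum.elim X z w - X i)]
    exact hF i
  · intro v c hc hs
    obtain ⟨k, hk⟩ := hloc (e.symm v) (c ∘ E.symm) (fun w hw => hc (E.symm w) (by
        rw [E.apply_symm_apply]; exact hw)) (by
      rw [← E.sum_comp]
      simpa only [hE, Function.comp_apply, E.symm_apply_apply] using hs)
    exact ⟨k, fun w => by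
      have := hk (E w)
      rwa [Function.comp_apply, E.symm_apply_apply] at this⟩
  · intro k hk
    obtain ⟨a, ha⟩ := hconn (k ∘ e) fun v w h => hk _ _ (by
      change ω (Sum.inr (e.symm (e v))) (Sum.inr (e.symm (e w))) ≠ 0
      simpa using h)
    exact ⟨a, fun v => by simpa using ha (e.symm v)⟩
  · obtain ⟨v, w, h⟩ := hne
    refine ⟨e v, E.symm w, ?_⟩
    rw [E.apply_symm_apply]
    change ω (Sum.inr (e.symm (e v))) w ≠ 0
    simpa using h

/-- The sum over the bars of a node with at most three bars. -/
theorem sum_three_bars {ι : Type} [Fintype ι] {E : Type} [AddCommGroup E] [Module ℝ E]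
    (p : ι → E) {A B C : ι} (hAB : A ≠ B) (hAC : A ≠ C) (hBC : B ≠ C) (ω : ι → ℝ)
    (hsupp : ∀ w, w ≠ A → w ≠ B → w ≠ C → ω w = 0) :
    ∑ w, ω w • p w = ω A • p A + ω B • p B + ω C • p C := by
  classical
  rw [← Finset.sum_subset (Finset.subset_univ {A, B, C})]
  · rw [Finset.sum_insert (by simp [hAB, hAC]), Finset.sum_insert (by simp [hBC]),
      Finset.sum_singleton, add_assoc]
  · intro w _ hw
    simp only [Finset.mem_insert, Finset.mem_singleton, not_or] at hw
    rw [hsupp w hw.1 hw.2.1 hw.2.2, zero_smul]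

/-- A node with three bars, two of which are not parallel, admits a single stress state up to
proportionality. -/
theorem three_bars_rigid {ι : Type} [Fintype ι] {E : Type} [AddCommGroup E] [Module ℝ E]
    (p : ι → E) {A B C : ι} (hAB : A ≠ B) (hAC : A ≠ C) (hBC : B ≠ C) (ω c : ι → ℝ)
    (hsupp : ∀ w, w ≠ A → w ≠ B → w ≠ C → ω w = 0)
    (hω : ω A • p A + ω B • p B + ω C • p C = 0) (hC : ω C ≠ 0)
    (hli : ∀ a b : ℝ, a • p A + b • p B = 0 → a = 0 ∧ b = 0)
    (hc : ∀ w, ω w = 0 → c w = 0) (hsum : ∑ w, c w • p w = 0) : ∃ k : ℝ, ∀ w, c w = k * ω w := by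
  have h1 : c A • p A + c B • p B + c C • p C = 0 := by
    rw [← hsum, sum_three_bars p hAB hAC hBC c fun w h₁ h₂ h₃ => hc w (hsupp w h₁ h₂ h₃)]
  -- Subtracting the multiple of `ω` that agrees with `c` on the bar `C` leaves a relation between
  -- the two independent bars.
  set k := c C / ω C with hk
  have hkC : c C = k * ω C := by rw [hk]; field_simp
  have h2 := hli (c A - k * ω A) (c B - k * ω B) (by
    have : (c A - k * ω A) • p A + (c B - k * ω B) • p B
        = (c A • p A + c B • p B + c C • p C) - k • (ω A • p A + ω B • p B + ω C • p C) := by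
      rw [hkC]; module
    rw [this, h1, hω]; simp)
  refine ⟨k, fun w => ?_⟩
  by_cases hA : w = A
  · subst hA; linarith [h2.1]
  by_cases hB : w = B
  · subst hB; linarith [h2.2]
  by_cases hC' : w = C
  · subst hC'; exact hkC
  · rw [hsupp w hA hB hC', hc w (hsupp w hA hB hC'), mul_zero]

/-! ### General position and construction of the string -/

section Lines

variable {E : Type*} [AddCommGroup E] [Module ℝ E]

/-- The point `z` is not on the line through `y` with direction `w`. -/
def OffLine (y w z : E) : Prop := ∀ c : ℝ, z - y ≠ c • w

/-- There is at most one bad parameter: two would make `q` parallel to `w` and put the whole line `p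
+ t • q` on the forbidden one, including the parameter `t₀`. -/
theorem finite_not_offLine {y w p q : E} {t₀ : ℝ} (h : OffLine y w (p + t₀ • q)) :
    {t : ℝ | ¬ OffLine y w (p + t • q)}.Finite := by
  refine Set.Subsingleton.finite fun t₁ h₁ t₂ h₂ => ?_
  by_contra hne
  simp only [OffLine, Set.mem_ofPred_eq, not_forall, not_not] at h₁ h₂
  obtain ⟨c₁, h₁⟩ := h₁
  obtain ⟨c₂, h₂⟩ := h₂
  have hne' : t₁ - t₂ ≠ 0 := sub_ne_zero.2 hne
  have hq : q = ((c₁ - c₂) / (t₁ - t₂)) • w := by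
    have : (t₁ - t₂) • q = (c₁ - c₂) • w := by
      rw [sub_smul c₁, ← h₁, ← h₂]; module
    rw [div_eq_inv_mul, mul_smul, ← this, inv_smul_smul₀ hne']
  refine h (c₁ + (t₀ - t₁) * ((c₁ - c₂) / (t₁ - t₂))) ?_
  rw [add_smul, ← h₁, mul_smul, ← hq]
  module

theorem finite_mem_line {p q : E} (hq : q ≠ 0) {A : Set E} (hA : A.Finite) :
    {t : ℝ | p + t • q ∈ A}.Finite := by
  refine hA.preimage fun t₁ _ t₂ _ h => ?_
  have h' : (t₁ - t₂) • q = 0 := by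
    rw [sub_smul, sub_eq_zero]; exact add_left_cancel h
  rcases smul_eq_zero.1 h' with h' | h'
  · exact sub_eq_zero.1 h'
  · exact absurd h' hq

theorem exists_mem_Ioo_not_mem {B : Set ℝ} (hB : B.Finite) : ∃ t : ℝ, 0 < t ∧ t < 1 ∧ t ∉ B := by
  obtain ⟨t, ht, htB⟩ := ((Set.Ioo_infinite (zero_lt_one' ℝ)).sdiff hB).nonempty
  exact ⟨t, ht.1, ht.2, htB⟩

/-- Otherwise the points `u` and `v` lie on the line through `y` with direction `w`, which is then
the line `uv` and contains `y`. -/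
theorem exists_offLine_of_offLine {u v y : E} (w : E) (huv : u ≠ v) (hy : OffLine u (v - u) y) :
    ∃ t : ℝ, OffLine y w (u + t • (v - u)) := by
  by_contra hno
  simp only [OffLine, not_exists, not_forall, not_not] at hno
  obtain ⟨c₀, h₀⟩ := hno 0
  obtain ⟨c₁, h₁⟩ := hno 1
  have hd : v - u = (c₁ - c₀) • w := by
    rw [sub_smul, ← h₀, ← h₁]; module
  have hne : c₁ - c₀ ≠ 0 := fun h => huv (by
    rw [h, zero_smul, sub_eq_zero] at hd; exact hd.symm)
  refine hy (-c₀ / (c₁ - c₀)) ?_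
  rw [hd, smul_smul, div_mul_cancel₀ _ hne, neg_smul, ← h₀]
  module

/-- The node before the `m`-th one in a string starting at `y`. -/
def prevNode (y : E) (P : ℕ → E) : ℕ → E
  | 0 => y
  | m + 1 => P m

/-- The nodes `P 0, …, P (n - 1)` of a string from `y` to a point `P n` of `T`, where `P m` is
pulled towards the point `a m` of the segment `[u m, v m]`. -/
structure IsString (T : Set E) (u v : ℕ → E) (y : E) (A : Set E) (n : ℕ)
    (t : ℕ → ℝ) (a P : ℕ → E) : Prop where
  last_mem : P n ∈ T
  param_pos : ∀ m < n, 0 < t m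
  param_lt : ∀ m < n, t m < 1
  anchor_eq : ∀ m < n, a m = u m + t m • (v m - u m)
  node_off : ∀ m < n, OffLine (u m) (v m - u m) (P m)
  anchor_notMem : ∀ m < n, a m ∉ A
  node_notMem : ∀ m < n, P m ∉ A
  anchor_ne : ∀ m < n, ∀ k < n, a m ≠ P k
  anchor_inj : ∀ m < n, ∀ k < n, a m = a k → m = k
  node_inj : ∀ m < n, ∀ k < n, P m = P k → m = k
  equilibrium : ∀ m < n, ∃ ρ κ : ℝ, 0 < ρ ∧ 0 < κ ∧
    ρ • (P (m + 1) - P m) + (prevNode y P m - P m) + κ • (a m - P m) = 0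
  rigid : ∀ m < n, OffLine (P m) (a m - P m) (P (m + 1))

/-- A string starting at the auxiliary point `y₁`, inside `[y, a₀]`, is extended backwards. Its
first bar is cut at `p`, between `y₁` and `P 0`, and the pull of `p` towards `y₁` is resolved into
pulls towards `y` and `a₀`. The node `P 0` is pulled in the same direction as before. -/
theorem IsString.cons {T : Set E} {u v : ℕ → E} {y y₁ : E} {A A₁ : Set E} {n : ℕ}
    {t : ℕ → ℝ} {a P : ℕ → E} {t₀ s η : ℝ} {a₀ p : E}
    (h : IsString T (fun m => u (m + 1)) (fun m => v (m + 1)) y₁ A₁ n t a P)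
    (hA : A ⊆ A₁) (ha₁ : a₀ ∈ A₁) (ht₀ : 0 < t₀) (ht₁ : t₀ < 1)
    (ha₀ : a₀ = u 0 + t₀ • (v 0 - u 0)) (ha₀A : a₀ ∉ A)
    (hs₀ : 0 < s) (hs₁ : s < 1) (hy₁ : y₁ = y + s • (a₀ - y)) (hay : a₀ ≠ y)
    (hη₀ : 0 < η) (hη₁ : η < 1) (hp : p = y₁ + η • (P 0 - y₁))
    (hoff : OffLine y₁ (a₀ - y) (P 0)) (hpL : OffLine (u 0) (v 0 - u 0) p)
    (hpA : p ∉ A) (hpa₀ : a₀ ≠ p) (hpa : ∀ m < n, a m ≠ p) (hpP : ∀ m < n, P m ≠ p) :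
    IsString T u v y A (n + 1) (fun m => Nat.casesOn m t₀ t) (fun m => Nat.casesOn m a₀ a)
      (fun m => Nat.casesOn m p P) where
  last_mem := h.last_mem
  param_pos
    | 0, _ => ht₀
    | m + 1, hm => h.param_pos m (by omega)
  param_lt
    | 0, _ => ht₁
    | m + 1, hm => h.param_lt m (by omega)
  anchor_eq
    | 0, _ => ha₀
    | m + 1, hm => h.anchor_eq m (by omega)
  node_off
    | 0, _ => hpL
    | m + 1, hm => h.node_off m (by omega)
  anchor_notMem
    | 0, _ => ha₀A
    | m + 1, hm => fun hc => h.anchor_notMem m (by omega) (hA hc)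
  node_notMem
    | 0, _ => hpA
    | m + 1, hm => fun hc => h.node_notMem m (by omega) (hA hc)
  anchor_ne
    | 0, _, 0, _ => hpa₀
    | 0, _, k + 1, hk => fun hc => h.node_notMem k (by omega) (by
      rw [show P k = a₀ from hc.symm]; exact ha₁)
    | m + 1, hm, 0, _ => hpa m (by omega)
    | m + 1, hm, k + 1, hk => h.anchor_ne m (by omega) k (by omega)
  anchor_inj
    | 0, _, 0, _ => fun _ => rfl
    | 0, _, k + 1, hk => fun hc => h.anchor_notMem k (by omega) (by
      rw [show a k = a₀ from hc.symm]; exact ha₁) |>.elim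
    | m + 1, hm, 0, _ => fun hc => h.anchor_notMem m (by omega) (by
      rw [show a m = a₀ from hc]; exact ha₁) |>.elim
    | m + 1, hm, k + 1, hk => fun hc => by rw [h.anchor_inj m (by omega) k (by omega) hc]
  node_inj
    | 0, _, 0, _ => fun _ => rfl
    | 0, _, k + 1, hk => fun hc => absurd hc.symm (hpP k (by omega))
    | m + 1, hm, 0, _ => fun hc => absurd hc (hpP m (by omega))
    | m + 1, hm, k + 1, hk => fun hc => by rw [h.node_inj m (by omega) k (by omega) hc]
  equilibrium
    | 0, _ => by
      have hη : 0 < 1 - η := by linarith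
      have hs : 0 < 1 - s := by linarith
      -- The pulls towards `y` and `a₀` are in the ratio `1 - s : s`, so that they add up along `y₁
      -- - p`. All is normalized to density `1` towards `y`.
      refine ⟨η / ((1 - η) * (1 - s)), s / (1 - s), by positivity, by positivity, ?_⟩
      have h1 : P 0 - p = (1 - η) • (P 0 - y₁) := by rw [hp]; module
      have h2 : (1 - s) • (y - p) + s • (a₀ - p) = -(η • (P 0 - y₁)) := by
        have : (1 - s) • (y - p) + s • (a₀ - p) = y₁ - p := by rw [hy₁]; module
        rw [this, hp]; module
      have h3 : (1 - s) • ((η / ((1 - η) * (1 - s))) • (P 0 - p) + (y - p)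
          + (s / (1 - s)) • (a₀ - p)) = 0 := by
        rw [h1]
        have e1 : (1 - s) * (η / ((1 - η) * (1 - s))) * (1 - η) = η := by field_simp
        have e2 : (1 - s) * (s / (1 - s)) = s := by field_simp
        rw [smul_add, smul_add, smul_smul, smul_smul, smul_smul, e1, e2, add_assoc, h2]
        exact add_neg_cancel _
      exact (smul_eq_zero.1 h3).resolve_left hs.ne'
    | 1, hm => by
      obtain ⟨ρ, κ, hρ, hκ, he⟩ := h.equilibrium 0 (by omega)
      have hη : 0 < 1 - η := by linarith
      -- The predecessor moves from `y₁` to `p`, which shortens the bar by the factor `1 - η`.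
      -- Scaling the other two densities by it restores equilibrium.
      refine ⟨(1 - η) * ρ, (1 - η) * κ, by positivity, by positivity, ?_⟩
      have h1 : p - P 0 = (1 - η) • (y₁ - P 0) := by rw [hp]; module
      change ((1 - η) * ρ) • (P 1 - P 0) + (p - P 0) + ((1 - η) * κ) • (a 0 - P 0) = 0
      rw [h1, mul_smul, mul_smul, ← smul_add, ← smul_add]
      exact (congrArg ((1 - η) • ·) he).trans (smul_zero _)
    | m + 2, hm => h.equilibrium (m + 1) (by omega)
  rigid
    | 0, _ => by
      intro c hc
      change P 0 - p = c • (a₀ - p) at hc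
      -- Parallel bars at `p` would put `P 0` on the line through `y` and `a₀`, against `hoff`.
      have h1 : (1 - η + c * η) • (P 0 - y₁) = (c * (1 - s)) • (a₀ - y) := by
        have e1 : (1 - η + c * η) • (P 0 - y₁) = (P 0 - p) - c • (a₀ - p) + c • (a₀ - y₁) := by
          rw [hp]; module
        rw [e1, hc, hy₁]; module
      by_cases h0 : 1 - η + c * η = 0
      · rw [h0, zero_smul] at h1
        rcases smul_eq_zero.1 h1.symm with h2 | h2
        · rcases mul_eq_zero.1 h2 with h3 | h3
          · rw [h3] at h0; linarith
          · linarith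
        · exact hay (sub_eq_zero.1 h2)
      · refine hoff ((1 - η + c * η)⁻¹ * (c * (1 - s))) ?_
        rw [mul_smul, ← h1, inv_smul_smul₀ h0]
    | m + 1, hm => h.rigid m (by omega)

/-- Strings with prescribed anchoring segments exist as soon as no line contains `T`. -/
theorem exists_isString {T : Set E} (hT : ∀ y w : E, ∃ x ∈ T, OffLine y w x) (n : ℕ) :
    ∀ (u v : ℕ → E), (∀ m, u m ≠ v m) → ∀ y w : E, (0 < n → OffLine (u 0) (v 0 - u 0) y) →
      ∀ A : Set E, A.Finite → ∃ t a P, IsString T u v y A n t a P ∧ OffLine y w (P 0) := by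
  induction n with
  | zero =>
    intro u v _ y w _ A _
    obtain ⟨x, hx, hoff⟩ := hT y w
    refine ⟨fun _ => 0, fun _ => x, fun _ => x, ?_, hoff⟩
    constructor <;> simp [hx]
  | succ n ih =>
    intro u v huv y w hy A hA
    replace hy := hy (Nat.succ_pos n)
    have hay : ∀ t : ℝ, u 0 + t • (v 0 - u 0) ≠ y := by
      intro t ht
      exact hy t (by rw [← ht]; module)
    have hvu : v 0 - u 0 ≠ 0 := sub_ne_zero.2 (huv 0).symm
    -- `hoffw` will keep the first node off the line required by the conclusion; `hoff₁` lets `y₁`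
    -- avoid the line of the next segment, as the induction hypothesis requires.
    obtain ⟨t₀, ht₀, ht₁, ha₀A, hoffw, hoff₁⟩ : ∃ t : ℝ, 0 < t ∧ t < 1 ∧
        u 0 + t • (v 0 - u 0) ∉ A ∧ OffLine y w (u 0 + t • (v 0 - u 0)) ∧
        OffLine y (v 1 - u 1) (u 0 + t • (v 0 - u 0)) := by
      obtain ⟨t₁, h₁⟩ := exists_offLine_of_offLine w (huv 0) hy
      obtain ⟨t₂, h₂⟩ := exists_offLine_of_offLine (v 1 - u 1) (huv 0) hy
      obtain ⟨t, h0, h1, hB⟩ := exists_mem_Ioo_not_mem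
        (((finite_mem_line hvu hA).union (finite_not_offLine h₁)).union (finite_not_offLine h₂))
      simp only [Set.mem_union, Set.mem_ofPred_eq, not_or, not_not] at hB
      exact ⟨t, h0, h1, hB.1.1, hB.1.2, hB.2⟩
    set a₀ := u 0 + t₀ • (v 0 - u 0) with ha₀
    obtain ⟨s, hs₀, hs₁, hsoff⟩ : ∃ s : ℝ, 0 < s ∧ s < 1 ∧
        OffLine (u 1) (v 1 - u 1) (y + s • (a₀ - y)) := by
      have : ∃ s : ℝ, OffLine (u 1) (v 1 - u 1) (y + s • (a₀ - y)) := by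
        by_cases h : OffLine (u 1) (v 1 - u 1) y
        · exact ⟨0, by simpa using h⟩
        · refine ⟨1, ?_⟩
          simp only [OffLine, not_forall, not_not] at h
          obtain ⟨c, hc⟩ := h
          intro c' hc'
          refine hoff₁ (c' - c) ?_
          rw [sub_smul, ← hc, ← hc']; module
      obtain ⟨s', hs'⟩ := this
      obtain ⟨s, h0, h1, hB⟩ := exists_mem_Ioo_not_mem (finite_not_offLine hs')
      exact ⟨s, h0, h1, not_not.1 hB⟩
    set y₁ := y + s • (a₀ - y) with hy₁
    -- The direction `a₀ - y` makes `P 0` avoid the line through `y` and `a₀`, as needed for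
    -- rigidity at the new node; inserting `a₀` into `A` keeps later points away from it.
    obtain ⟨t, a, P, hstr, hoff⟩ := ih (fun m => u (m + 1)) (fun m => v (m + 1))
      (fun m => huv (m + 1)) y₁ (a₀ - y) (fun _ => hsoff) (insert a₀ A) (hA.insert a₀)
    have hPy : P 0 - y₁ ≠ 0 := by simpa using hoff 0
    obtain ⟨η, hη₀, hη₁, hpA, hpa₀, hpa, hpP, hpw, hpL⟩ : ∃ η : ℝ, 0 < η ∧ η < 1 ∧
        y₁ + η • (P 0 - y₁) ∉ A ∧ a₀ ≠ y₁ + η • (P 0 - y₁) ∧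
        (∀ m < n, a m ≠ y₁ + η • (P 0 - y₁)) ∧ (∀ m < n, P m ≠ y₁ + η • (P 0 - y₁)) ∧
        OffLine y w (y₁ + η • (P 0 - y₁)) ∧
        OffLine (u 0) (v 0 - u 0) (y₁ + η • (P 0 - y₁)) := by
      -- The two conditions hold at `η = 0`, that is at `y₁`, hence for all but finitely many `η`.
      have h₁ : OffLine y w (y₁ + (0 : ℝ) • (P 0 - y₁)) := by
        intro c hc
        refine hoffw (c / s) ?_
        have : s • (a₀ - y) = c • w := by rw [← hc, hy₁]; module
        rw [div_eq_inv_mul, mul_smul, ← this, inv_smul_smul₀ hs₀.ne']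
      have h₂ : OffLine (u 0) (v 0 - u 0) (y₁ + (0 : ℝ) • (P 0 - y₁)) := by
        intro c hc
        have hs : (1 - s) ≠ 0 := by linarith
        refine hy ((c - s * t₀) / (1 - s)) ?_
        have : (1 - s) • (y - u 0) = (c - s * t₀) • (v 0 - u 0) := by
          rw [sub_smul c, ← hc, hy₁, ha₀]; module
        rw [div_eq_inv_mul, mul_smul, ← this, inv_smul_smul₀ hs]
      obtain ⟨η, h0, h1, hB⟩ := exists_mem_Ioo_not_mem
        ((finite_mem_line (p := y₁) hPy ((hA.insert a₀).union
          (((Set.finite_Iio n).image a).union ((Set.finite_Iio n).image P)))).union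
          ((finite_not_offLine h₁).union (finite_not_offLine h₂)))
      simp only [Set.mem_union, Set.mem_ofPred_eq, not_or, not_not, Set.mem_insert_iff,
        Set.mem_image, Set.mem_Iio, not_exists, not_and] at hB
      obtain ⟨⟨⟨hB1, hB2⟩, hB3, hB4⟩, hB5, hB6⟩ := hB
      exact ⟨η, h0, h1, hB2, fun h => hB1 h.symm, hB3, hB4, hB5, hB6⟩
    exact ⟨_, _, _, hstr.cons (Set.subset_insert _ _) (Set.mem_insert _ _) ht₀ ht₁ ha₀ ha₀A hs₀
      hs₁ hy₁ (hay t₀) hη₀ hη₁ rfl hoff hpL hpA hpa₀ hpa hpP, hpw⟩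

end Lines

/-! ### Densities and balance of the string -/

/-- Equilibrium at `P m` fixes the ratio `ρ m` of the densities of the outgoing and incoming bars,
so the densities along the string are products of these ratios. -/
theorem exists_string_densities {E : Type*} [AddCommGroup E] [Module ℝ E] {T : Set E}
    {u v : ℕ → E} {y : E} {A : Set E} {n : ℕ} {t : ℕ → ℝ} {a P : ℕ → E}
    (h : IsString T u v y A n t a P) :
    ∃ τ D : ℕ → ℝ, (∀ m, 0 < τ m) ∧ (∀ m, 0 < D m) ∧ ∀ m < n,
      τ (m + 1) • (P (m + 1) - P m) + τ m • (prevNode y P m - P m) + D m • (a m - P m) = 0 := by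
  have h1 : ∀ m, ∃ ρ κ : ℝ, 0 < ρ ∧ 0 < κ ∧ (m < n →
      ρ • (P (m + 1) - P m) + (prevNode y P m - P m) + κ • (a m - P m) = 0) := by
    intro m
    by_cases hm : m < n
    · obtain ⟨ρ, κ, hρ, hκ, he⟩ := h.equilibrium m hm
      exact ⟨ρ, κ, hρ, hκ, fun _ => he⟩
    · exact ⟨1, 1, one_pos, one_pos, fun hm' => absurd hm' hm⟩
  choose ρ κ hρ hκ he using h1
  let τ : ℕ → ℝ := fun m => ∏ k ∈ Finset.range m, ρ k
  have hτ : ∀ m, 0 < τ m := fun m => Finset.prod_pos fun k _ => hρ k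
  refine ⟨τ, fun m => τ m * κ m, hτ, fun m => mul_pos (hτ m) (hκ m), fun m hm => ?_⟩
  have : τ (m + 1) = τ m * ρ m := Finset.prod_range_succ _ _
  rw [this, mul_smul, mul_smul, ← smul_add, ← smul_add, he m hm, smul_zero]

/-- The `(a, b)` component of the total moment of a loading. -/
noncomputable def momentMap {d N : ℕ} (X : Fin N → Vec d) (a b : Fin d) :
    (Fin N → Vec d) →ₗ[ℝ] ℝ where
  toFun F := ∑ i, (F i a * X i b - X i a * F i b)
  map_add' F G := by
    rw [← Finset.sum_add_distrib]
    refine Finset.sum_congr rfl fun i _ => ?_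
    simp only [Pi.add_apply, PiLp.add_apply]
    ring
  map_smul' c F := by
    rw [RingHom.id_apply, smul_eq_mul, Finset.mul_sum]
    refine Finset.sum_congr rfl fun i _ => ?_
    simp only [Pi.smul_apply, PiLp.smul_apply, smul_eq_mul]
    ring

theorem momentMap_single {d N : ℕ} (X : Fin N → Vec d) (a b : Fin d) (k : Fin N) (v : Vec d) :
    momentMap X a b (Pi.single k v) = v a * X k b - X k a * v b := by
  change ∑ i, ((Pi.single k v : Fin N → Vec d) i a * X i b
    - X i a * (Pi.single k v : Fin N → Vec d) i b) = _
  rw [Finset.sum_eq_single k]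
  · simp
  · intro c _ hc; simp [Pi.single_eq_of_ne hc]
  · simp

/-- The loading of a string whose pull `D m • (P m - a m)` is distributed to the end points of the
anchoring segments. -/
noncomputable def stringLoading {d N : ℕ} (X : Fin N → Vec d) (n : ℕ) (idx : ℕ → Fin N × Fin N)
    (α β : Fin N) (t τ D : ℕ → ℝ) (a P : ℕ → Vec d) : Fin N → Vec d :=
  -(∑ m ∈ Finset.range n, (Pi.single (idx m).1 (((1 - t m) * D m) • (P m - a m))
      + Pi.single (idx m).2 ((t m * D m) • (P m - a m))))
    - Pi.single α (τ 0 • (P 0 - X α)) - Pi.single β (τ n • (prevNode (X α) P n - X β))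

/-- Resultant and moment telescope along the string. The force `S m` of a bar has the same moment at
both its ends, the pull at `P m` has the same moment at `a m`, and sharing it between the segment
ends with weights `1 - t m` and `t m` changes neither resultant nor moment. -/
theorem stringLoading_mem_balanced {d N : ℕ} {X : Fin N → Vec d} {n : ℕ}
    {idx : ℕ → Fin N × Fin N} {α β : Fin N} {t τ D : ℕ → ℝ} {a P : ℕ → Vec d} {A : Set (Vec d)}
    (h : IsString (Set.range X) (fun m => X (idx m).1) (fun m => X (idx m).2) (X α) A n t a P)
    (hβ : P n = X β)
    (he : ∀ m < n, τ (m + 1) • (P (m + 1) - P m) + τ m • (prevNode (X α) P m - P m)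
      + D m • (a m - P m) = 0) :
    stringLoading X n idx α β t τ D a P ∈ balancedLoadings X := by
  let S : ℕ → Vec d := fun m => τ m • (P m - prevNode (X α) P m)
  have hS : ∀ m < n, D m • (P m - a m) = S (m + 1) - S m := by
    intro m hm
    have e1 : S (m + 1) = τ (m + 1) • (P (m + 1) - P m) := rfl
    have e2 : D m • (P m - a m) = S (m + 1) - S m - (τ (m + 1) • (P (m + 1) - P m)
        + τ m • (prevNode (X α) P m - P m) + D m • (a m - P m)) := by
      rw [e1]; simp only [S]; module
    rw [e2, he m hm, sub_zero]
  have hS0 : τ 0 • (P 0 - X α) = S 0 := rfl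
  have hSn : τ n • (prevNode (X α) P n - X β) = -S n := by simp only [S, hβ]; module
  refine ⟨?_, fun b c => ?_⟩
  · have hsum : ∀ G : Fin N → Vec d, ∑ i, G i = (∑ i, LinearMap.proj (R := ℝ) i) G := by
      intro G; simp [LinearMap.sum_apply]
    have hsingle : ∀ (k : Fin N) (v : Vec d),
        (∑ i, LinearMap.proj (R := ℝ) (φ := fun _ : Fin N => Vec d) i) (Pi.single k v) = v := by
      intro k v; rw [← hsum]; simp
    rw [hsum, stringLoading, map_sub, map_sub, map_neg, map_sum, hsingle, hsingle]
    have : ∀ m ∈ Finset.range n,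
        (∑ i, LinearMap.proj (R := ℝ) (φ := fun _ : Fin N => Vec d) i)
          (Pi.single (idx m).1 (((1 - t m) * D m) • (P m - a m))
            + Pi.single (idx m).2 ((t m * D m) • (P m - a m))) = S (m + 1) - S m := by
      intro m hm
      rw [map_add, hsingle, hsingle, ← hS m (Finset.mem_range.1 hm)]; module
    rw [Finset.sum_congr rfl this, Finset.sum_range_sub, hS0, hSn]
    abel
  · change momentMap X b c (stringLoading X n idx α β t τ D a P) = 0
    rw [stringLoading, map_sub, map_sub, map_neg, map_sum, momentMap_single, momentMap_single]
    have : ∀ m ∈ Finset.range n,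
        momentMap X b c (Pi.single (idx m).1 (((1 - t m) * D m) • (P m - a m))
            + Pi.single (idx m).2 ((t m * D m) • (P m - a m)))
          = (S (m + 1) b * P (m + 1) c - P (m + 1) b * S (m + 1) c)
            - (S m b * P m c - P m b * S m c) := by
      intro m hm
      have hm := Finset.mem_range.1 hm
      have e1 : ∀ i, D m * (P m i - a m i) = S (m + 1) i - S m i := fun i => by
        simpa using congrArg (fun x : Vec d => x i) (hS m hm)
      have e2 : ∀ i, a m i = X (idx m).1 i + t m * (X (idx m).2 i - X (idx m).1 i) := fun i => by
        simpa using congrArg (fun x : Vec d => x i) (h.anchor_eq m hm)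
      have e3 : ∀ i, S (m + 1) i = τ (m + 1) * (P (m + 1) i - P m i) := fun i => by
        simp [S, prevNode]
      rw [map_add, momentMap_single, momentMap_single]
      simp only [PiLp.smul_apply, PiLp.sub_apply, smul_eq_mul]
      have e4 : (D m * (P m b - a m b)) * a m c - a m b * (D m * (P m c - a m c))
          = (D m * (P m b - a m b)) * P m c - P m b * (D m * (P m c - a m c)) := by ring
      have e5 : S (m + 1) b * P (m + 1) c - P (m + 1) b * S (m + 1) c
          = S (m + 1) b * P m c - P m b * S (m + 1) c := by
        rw [e3, e3]; ring
      have e6 : (1 - t m) * D m * (P m b - a m b) * X (idx m).1 c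
            - X (idx m).1 b * ((1 - t m) * D m * (P m c - a m c))
            + (t m * D m * (P m b - a m b) * X (idx m).2 c
            - X (idx m).2 b * (t m * D m * (P m c - a m c)))
          = (D m * (P m b - a m b)) * (X (idx m).1 c + t m * (X (idx m).2 c - X (idx m).1 c))
            - (X (idx m).1 b + t m * (X (idx m).2 b - X (idx m).1 b))
              * (D m * (P m c - a m c)) := by ring
      rw [e6, ← e2, ← e2, e4, e5, e1, e1]
      ring
    rw [Finset.sum_congr rfl this,
      Finset.sum_range_sub (fun m => S m b * P m c - P m b * S m c), hS0, hSn, hβ]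
    have e0 : ∀ i, S 0 i = τ 0 * (P 0 i - X α i) := fun i => by simp [S, prevNode]
    simp only [PiLp.neg_apply, e0]
    ring

/-- Keeps the nodes distinct under a small perturbation: limits of distinct nodes have disjoint
neighbourhoods, and there are finitely many pairs. -/
theorem eventually_injective {ι E : Type*} [Finite ι] [TopologicalSpace E] [T2Space E]
    {l : Filter ℝ} {f : ℝ → ι → E} {f₀ : ι → E} (hf₀ : Function.Injective f₀)
    (hf : ∀ i, Filter.Tendsto (fun ε => f ε i) l (nhds (f₀ i))) :
    ∀ᶠ ε in l, Function.Injective (f ε) := by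
  have : ∀ i j, ∀ᶠ ε in l, f ε i = f ε j → i = j := by
    intro i j
    by_cases hij : i = j
    · exact Filter.Eventually.of_forall fun _ _ => hij
    · obtain ⟨U, V, hU, hV, hi, hj, hd⟩ := t2_separation fun h => hij (hf₀ h)
      filter_upwards [(hf i).eventually (hU.mem_nhds hi), (hf j).eventually (hV.mem_nhds hj)]
        with ε h₁ h₂ h
      exact (Set.disjoint_left.1 hd h₁ (h ▸ h₂)).elim
  have h2 : ∀ᶠ ε in l, ∀ i j, f ε i = f ε j → i = j :=
    Filter.eventually_all.2 fun i => Filter.eventually_all.2 fun j => this i j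
  filter_upwards [h2] with ε hε i j h using hε i j h

/-! ### The web made of a string and linking nodes -/

/-- The force densities of a web made of a string and of `n` nodes linking it to pairs of terminals:
`g₁, g₂` towards the two terminals, `B` towards the string and `τ` along the string. -/
noncomputable def stringWebDensity {N n : ℕ} (idx : ℕ → Fin N × Fin N) (α β : Fin N)
    (g₁ g₂ B τ : ℕ → ℝ) : Fin N ⊕ (Fin n ⊕ Fin n) → Fin N ⊕ (Fin n ⊕ Fin n) → ℝ
  | .inl _, .inl _ => 0
  | .inl i, .inr (.inl m) | .inr (.inl m), .inl i =>
      if i = (idx m).1 then g₁ m else if i = (idx m).2 then g₂ m else 0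
  | .inl i, .inr (.inr m) | .inr (.inr m), .inl i =>
      (if m.1 = 0 ∧ i = α then τ 0 else 0) + (if m.1 + 1 = n ∧ i = β then τ n else 0)
  | .inr (.inl _), .inr (.inl _) => 0
  | .inr (.inl m), .inr (.inr k) | .inr (.inr k), .inr (.inl m) => if m = k then B m else 0
  | .inr (.inr m), .inr (.inr k) =>
      if k.1 = m.1 + 1 then τ k else if m.1 = k.1 + 1 then τ m else 0

theorem stringWebDensity_comm {N n : ℕ} (idx : ℕ → Fin N × Fin N) (α β : Fin N)
    (g₁ g₂ B τ : ℕ → ℝ) (v w : Fin N ⊕ (Fin n ⊕ Fin n)) :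
    stringWebDensity idx α β g₁ g₂ B τ v w = stringWebDensity idx α β g₁ g₂ B τ w v := by
  rcases v with i | m | m <;> rcases w with j | k | k <;> simp only [stringWebDensity]
  split_ifs <;> first | rfl | omega

theorem stringWebDensity_nonneg {N n : ℕ} {idx : ℕ → Fin N × Fin N} {α β : Fin N}
    {g₁ g₂ B τ : ℕ → ℝ} (hg₁ : ∀ m < n, 0 < g₁ m) (hg₂ : ∀ m < n, 0 < g₂ m)
    (hB : ∀ m < n, 0 < B m) (hτ : ∀ m, 0 < τ m) (v w : Fin N ⊕ (Fin n ⊕ Fin n)) :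
    0 ≤ stringWebDensity idx α β g₁ g₂ B τ v w := by
  have h0 := (hτ 0).le
  have hn := (hτ n).le
  have hq : ∀ (i : Fin N) (m : Fin n),
      0 ≤ if i = (idx m).1 then g₁ m else if i = (idx m).2 then g₂ m else 0 := fun i m => by
    have := (hg₁ m m.2).le
    have := (hg₂ m m.2).le
    split_ifs <;> first | assumption | exact le_rfl
  have hp : ∀ (i : Fin N) (m : Fin n), 0 ≤ (if m.1 = 0 ∧ i = α then τ 0 else 0)
      + (if m.1 + 1 = n ∧ i = β then τ n else 0) := fun i m => by
    split_ifs <;> linarith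
  have hb : ∀ m k : Fin n, 0 ≤ if m = k then B m else 0 := fun m k => by
    have := (hB m m.2).le
    split_ifs <;> first | assumption | exact le_rfl
  rcases v with i | m | m <;> rcases w with j | k | k <;> simp only [stringWebDensity]
  all_goals first
    | exact le_rfl
    | exact hq _ _
    | exact hp _ _
    | exact hb _ _
    | skip
  have := (hτ m).le
  have := (hτ k).le
  split_ifs <;> first | assumption | exact le_rfl

/-- A string and nodes linking it to pairs of terminals form a web supporting one ray only. -/
theorem exists_uniloadable_stringWeb {d N n : ℕ} (hn : 2 ≤ n) {X : Fin N → Vec d}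
    {idx : ℕ → Fin N × Fin N} (hidx : ∀ m, (idx m).1 ≠ (idx m).2) {α β : Fin N}
    {q P : ℕ → Vec d} {g₁ g₂ B τ : ℕ → ℝ}
    (hg₁ : ∀ m < n, 0 < g₁ m) (hg₂ : ∀ m < n, 0 < g₂ m)
    (hB : ∀ m < n, 0 < B m) (hτ : ∀ m, 0 < τ m)
    (hinj : Function.Injective (Sum.elim X (Sum.elim (fun m : Fin n => q m) fun m : Fin n => P m)))
    (hP : P n = X β)
    (hq : ∀ m < n, B m • (P m - q m) + g₁ m • (X (idx m).1 - q m)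
      + g₂ m • (X (idx m).2 - q m) = 0)
    (hql : ∀ m < n, ∀ b c : ℝ, b • (P m - q m) + c • (X (idx m).1 - q m) = 0 → b = 0 ∧ c = 0)
    (hp : ∀ m < n, τ (m + 1) • (P (m + 1) - P m) + B m • (q m - P m)
      + τ m • (prevNode (X α) P m - P m) = 0)
    (hpl : ∀ m < n, ∀ b c : ℝ, b • (P (m + 1) - P m) + c • (q m - P m) = 0 → b = 0 ∧ c = 0)
    {F : Fin N → Vec d}
    (hF : F + ∑ m ∈ Finset.range n, (Pi.single (idx m).1 (g₁ m • (q m - X (idx m).1))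
        + Pi.single (idx m).2 (g₂ m • (q m - X (idx m).2)))
      + Pi.single α (τ 0 • (P 0 - X α)) + Pi.single β (τ n • (prevNode (X α) P n - X β)) = 0) :
    ∃ W : FiniteWeb X, W.supportedLoadings = {G | ∃ c : ℝ, 0 ≤ c ∧ G = c • F} := by
  classical
  set z : Fin n ⊕ Fin n → Vec d := Sum.elim (fun m : Fin n => q m) fun m : Fin n => P m with hz
  set ω : Fin N ⊕ (Fin n ⊕ Fin n) → Fin N ⊕ (Fin n ⊕ Fin n) → ℝ :=
    stringWebDensity idx α β g₁ g₂ B τ with hω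
  have hpos : ∀ v w, 0 ≤ ω v w := stringWebDensity_nonneg hg₁ hg₂ hB hτ
  have hsymm : ∀ v w, ω v w = ω w v := stringWebDensity_comm idx α β g₁ g₂ B τ
  -- the bars of a linking node
  have hqs : ∀ (m : Fin n) w, w ≠ .inr (.inr m) → w ≠ .inl (idx m).1 → w ≠ .inl (idx m).2 →
      ω (.inr (.inl m)) w = 0 := by
    rintro m (i | k | k) h1 h2 h3
    · have h2' : i ≠ (idx m).1 := fun h => h2 (by rw [h])
      have h3' : i ≠ (idx m).2 := fun h => h3 (by rw [h])
      simp [hω, stringWebDensity, h2', h3']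
    · rfl
    · have : m ≠ k := fun h => h1 (by rw [h])
      simp [hω, stringWebDensity, this]
  have hqA : ∀ m : Fin n, ω (.inr (.inl m)) (.inr (.inr m)) = B m := fun m => by
    simp [hω, stringWebDensity]
  have hqB : ∀ m : Fin n, ω (.inr (.inl m)) (.inl (idx m).1) = g₁ m := fun m => by
    simp [hω, stringWebDensity]
  have hqC : ∀ m : Fin n, ω (.inr (.inl m)) (.inl (idx m).2) = g₂ m := fun m => by
    simp [hω, stringWebDensity, (hidx m).symm]
  -- the bars of a node of the string
  let next : Fin n → Fin N ⊕ (Fin n ⊕ Fin n) := fun m =>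
    if h : m.1 + 1 < n then .inr (.inr ⟨m.1 + 1, h⟩) else .inl β
  let prev : Fin n → Fin N ⊕ (Fin n ⊕ Fin n) := fun m =>
    if h : m.1 = 0 then .inl α else .inr (.inr ⟨m.1 - 1, by omega⟩)
  have hps : ∀ (m : Fin n) w, w ≠ next m → w ≠ .inr (.inl m) → w ≠ prev m →
      ω (.inr (.inr m)) w = 0 := by
    rintro m (i | k | k) h1 h2 h3
    · have e1 : ¬ (m.1 = 0 ∧ i = α) := fun h => h3 (by simp [prev, h.1, h.2])
      have e2 : ¬ (m.1 + 1 = n ∧ i = β) := fun h => h1 (by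
        have : ¬ m.1 + 1 < n := by omega
        simp [next, this, h.2])
      simp [hω, stringWebDensity, e1, e2]
    · have : k ≠ m := fun h => h2 (by rw [h])
      simp [hω, stringWebDensity, this]
    · have e1 : ¬ k.1 = m.1 + 1 := fun h => h1 (by
        have : m.1 + 1 < n := by omega
        simp only [next, this, dite_true]
        congr 2
        exact Fin.ext h)
      have e2 : ¬ m.1 = k.1 + 1 := fun h => h3 (by
        have : ¬ m.1 = 0 := by omega
        simp only [prev, this, dite_false]
        congr 2
        exact Fin.ext (by simp only; omega))
      simp [hω, stringWebDensity, e1, e2]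
  have hpA : ∀ m : Fin n, ω (.inr (.inr m)) (next m) = τ (m + 1) := fun m => by
    by_cases h : m.1 + 1 < n
    · simp [hω, stringWebDensity, next, h]
    · have e1 : m.1 ≠ 0 := by omega
      have e2 : m.1 + 1 = n := by omega
      simp [hω, stringWebDensity, next, e1, e2]
  have hpB : ∀ m : Fin n, ω (.inr (.inr m)) (.inr (.inl m)) = B m := fun m => by
    simp [hω, stringWebDensity]
  have hpC : ∀ m : Fin n, ω (.inr (.inr m)) (prev m) = τ m := fun m => by
    by_cases h : m.1 = 0
    · have e3 : ¬ 1 = n := by omega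
      simp [hω, stringWebDensity, prev, h, e3]
    · have e1 : ¬ m.1 - 1 = m.1 + 1 := by omega
      have e2 : m.1 = m.1 - 1 + 1 := by omega
      simp only [hω, stringWebDensity, prev, h, dite_false, e1, if_false]
      rw [if_pos e2]
  have hpnext : ∀ m : Fin n, Sum.elim X z (next m) = P (m + 1) := fun m => by
    by_cases h : m.1 + 1 < n
    · simp [next, h, hz]
    · have e2 : m.1 + 1 = n := by omega
      simp [next, e2, hP]
  have hpprev : ∀ m : Fin n, Sum.elim X z (prev m) = prevNode (X α) P m := fun m => by
    by_cases h : m.1 = 0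
    · simp [prev, h, prevNode]
    · obtain ⟨k, hk⟩ := Nat.exists_eq_succ_of_ne_zero h
      simp [prev, hk, hz, prevNode]
  -- Here `2 ≤ n` matters: a single string node would have both `α` and `β` as neighbours, and these
  -- may coincide.
  have hnp : ∀ m, next m ≠ prev m := fun m h => by
    by_cases h1 : m.1 + 1 < n <;> by_cases h2 : m.1 = 0
    · simp only [next, prev, dif_pos h1, dif_pos h2] at h
      exact Sum.inr_ne_inl h
    · simp only [next, prev, dif_pos h1, dif_neg h2, Sum.inr.injEq, Fin.mk.injEq] at h
      omega
    · omega
    · simp [next, prev, h1, h2] at h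
  have hnq : ∀ m, next m ≠ .inr (.inl m) := fun m h => by
    simp only [next] at h
    split_ifs at h
    simp at h
  have hpq : ∀ m, (.inr (.inl m)) ≠ prev m := fun m h => by
    simp only [prev] at h
    split_ifs at h
    simp at h
  have hC12 : ∀ m : Fin n, (.inl (idx m).1 : Fin N ⊕ (Fin n ⊕ Fin n)) ≠ .inl (idx m).2 :=
    fun m h => hidx m (Sum.inl_injective h)
  refine exists_uniloadable_web X F z hinj ω hsymm hpos ?_ (fun i j => rfl) ?_ ?_ ?_ ?_ ?_
  · rintro (i | m | m)
    · rfl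
    · rfl
    · simp [hω, stringWebDensity]
  · rintro (m | m)
    · rw [sum_three_bars (fun w => Sum.elim X z w - z (.inl m)) Sum.inr_ne_inl Sum.inr_ne_inl
        (hC12 m) (ω (.inr (.inl m))) (hqs m), hqA, hqB, hqC]
      exact hq m m.2
    · rw [sum_three_bars (fun w => Sum.elim X z w - z (.inr m)) (hnq m) (hnp m) (hpq m)
        (ω (.inr (.inr m))) (hps m), hpA, hpB, hpC, hpnext, hpprev]
      exact hp m m.2
  · intro i
    have h1 := congrFun hF i
    simp only [Pi.add_apply, Finset.sum_apply, Pi.zero_apply] at h1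
    rw [Fintype.sum_sum_type, Fintype.sum_sum_type]
    have e1 : ∀ j : Fin N, ω (.inl i) (.inl j) = 0 := fun j => rfl
    have e2 : ∑ m : Fin n, ω (.inl i) (.inr (.inl m)) • (Sum.elim X z (.inr (.inl m)) - X i)
        = ∑ m ∈ Finset.range n,
          ((Pi.single (idx m).1 (g₁ m • (q m - X (idx m).1)) : Fin N → Vec d) i
            + (Pi.single (idx m).2 (g₂ m • (q m - X (idx m).2)) : Fin N → Vec d) i) := by
      rw [← Fin.sum_univ_eq_sum_range (fun m =>
          (Pi.single (idx m).1 (g₁ m • (q m - X (idx m).1)) : Fin N → Vec d) i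
            + (Pi.single (idx m).2 (g₂ m • (q m - X (idx m).2)) : Fin N → Vec d) i)]
      refine Finset.sum_congr rfl fun m _ => ?_
      by_cases h1 : i = (idx m).1
      · have h2 : i ≠ (idx m).2 := h1 ▸ hidx m
        rw [Pi.single_eq_of_ne h2, hsymm, h1, hqB]
        simp [hz]
      · by_cases h2 : i = (idx m).2
        · rw [Pi.single_eq_of_ne h1, hsymm, h2, hqC]
          simp [hz]
        · rw [Pi.single_eq_of_ne h1, Pi.single_eq_of_ne h2]
          simp [hω, stringWebDensity, h1, h2]
    have e3 : ∑ m : Fin n, ω (.inl i) (.inr (.inr m)) • (Sum.elim X z (.inr (.inr m)) - X i)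
        = (Pi.single α (τ 0 • (P 0 - X α)) : Fin N → Vec d) i
          + (Pi.single β (τ n • (prevNode (X α) P n - X β)) : Fin N → Vec d) i := by
      have e4 : ∀ m : Fin n, ω (.inl i) (.inr (.inr m)) • (Sum.elim X z (.inr (.inr m)) - X i)
          = (if m = ⟨0, by omega⟩ then
              (Pi.single α (τ 0 • (P 0 - X α)) : Fin N → Vec d) i else 0)
            + (if m = ⟨n - 1, by omega⟩ then
              (Pi.single β (τ n • (prevNode (X α) P n - X β)) : Fin N → Vec d) i else 0) := by
        intro m
        have c1 : m = ⟨0, by omega⟩ ↔ m.1 = 0 := Fin.ext_iff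
        have c2 : m = ⟨n - 1, by omega⟩ ↔ m.1 + 1 = n := by
          rw [Fin.ext_iff]; simp only; omega
        simp only [c1, c2]
        change ((if m.1 = 0 ∧ i = α then τ 0 else 0)
          + (if m.1 + 1 = n ∧ i = β then τ n else 0)) • (P m - X i) = _
        rw [add_smul]
        congr 1
        · by_cases h1 : m.1 = 0
          · by_cases h2 : i = α
            · have h3 : P m = P 0 := by rw [h1]
              rw [if_pos ⟨h1, h2⟩, if_pos h1, h3, h2, Pi.single_eq_same]
            · simp [h2]
          · simp [h1]
        · by_cases h1 : m.1 + 1 = n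
          · have h3 : prevNode (X α) P n = P m := congrArg (prevNode (X α) P) h1.symm
            by_cases h2 : i = β
            · rw [if_pos ⟨h1, h2⟩, if_pos h1, h3, h2, Pi.single_eq_same]
            · simp [h2]
          · simp [h1]
      rw [Finset.sum_congr rfl fun m _ => e4 m, Finset.sum_add_distrib, Finset.sum_ite_eq',
        Finset.sum_ite_eq']
      simp
    rw [e2, e3]
    simp only [e1, zero_smul, Finset.sum_const_zero, zero_add]
    rw [← h1]
    abel
  · rintro (m | m) c hc hs
    · refine three_bars_rigid (fun w => Sum.elim X z w - z (.inl m)) Sum.inr_ne_inl Sum.inr_ne_inl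
        (hC12 m) (ω (.inr (.inl m))) c (hqs m) ?_ ?_ ?_ hc hs
      · rw [hqA, hqB, hqC]; exact hq m m.2
      · rw [hqC]; exact (hg₂ m m.2).ne'
      · exact hql m m.2
    · refine three_bars_rigid (fun w => Sum.elim X z w - z (.inr m)) (hnq m) (hnp m) (hpq m)
        (ω (.inr (.inr m))) c (hps m) ?_ ?_ ?_ hc hs
      · rw [hpA, hpB, hpC, hpnext, hpprev]; exact hp m m.2
      · rw [hpC]; exact (hτ m).ne'
      · rw [hpnext]; exact hpl m m.2
  · intro k hk
    have h1 : ∀ m : Fin n, k (.inl m) = k (.inr m) := fun m =>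
      hk _ _ (by rw [hqA]; exact (hB m m.2).ne')
    -- The factor propagates along the string; each linking node then inherits it from its string
    -- node by `h1`.
    have h2 : ∀ (m : ℕ) (hm : m < n), k (.inr ⟨m, hm⟩) = k (.inr ⟨0, by omega⟩) := by
      intro m
      induction m with
      | zero => intro _; rfl
      | succ m ih =>
        intro hm
        rw [← ih (by omega)]
        refine (hk _ _ ?_).symm
        have := hpA ⟨m, by omega⟩
        simp only [next, hm, dite_true] at this
        rw [this]
        exact (hτ _).ne'
    refine ⟨k (.inr ⟨0, by omega⟩), ?_⟩
    rintro (m | m)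
    · rw [h1]; exact h2 m m.2
    · exact h2 m m.2
  · exact ⟨.inl ⟨0, by omega⟩, .inr (.inr ⟨0, by omega⟩), by
      rw [hqA]; exact (hB 0 (by omega)).ne'⟩

/-! ### Perturbing the pair densities -/

/-- Positive densities in all the pairs of at least three noncollinear terminals can be realized by
a web supporting one ray only. -/
theorem exists_uniloadable_of_densities {d N n : ℕ} (hn : 2 ≤ n) {X : Fin N → Vec d}
    (hX : Function.Injective X) (hline : ∀ y w : Vec d, ∃ i, OffLine y w (X i))
    {idx : ℕ → Fin N × Fin N} (hidx : ∀ m, (idx m).1 ≠ (idx m).2)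
    {s : ℕ → ℝ} (hs : ∀ m, 0 < s m)
    (hspan : ∀ G ∈ balancedLoadings X, ∃ r : ℕ → ℝ,
      G = ∑ m ∈ Finset.range n, r m • pairLoading X (idx m)) :
    ∃ W : FiniteWeb X, W.supportedLoadings = {G | ∃ c : ℝ, 0 ≤ c ∧
      G = c • ∑ m ∈ Finset.range n, s m • pairLoading X (idx m)} := by
  obtain ⟨α, hα⟩ := hline (X (idx 0).1) (X (idx 0).2 - X (idx 0).1)
  obtain ⟨t, a, P, hstr, -⟩ := exists_isString (T := Set.range X)
    (fun y w => (hline y w).elim fun i hi => ⟨X i, ⟨i, rfl⟩, hi⟩) n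
    (fun m => X (idx m).1) (fun m => X (idx m).2) (fun m h => hidx m (hX h)) (X α) 0
    (fun _ => hα) (Set.range X) (Set.finite_range X)
  obtain ⟨β, hβ⟩ := hstr.last_mem
  obtain ⟨T, D, hT, hD, he⟩ := exists_string_densities hstr
  obtain ⟨r, hr⟩ := hspan _ (stringLoading_mem_balanced hstr hβ.symm he)
  -- `s'` compensates for the loading of the string scaled by `ε`. The displacement `γ` is set by
  -- equilibrium at `q`: with total density `s' / (t * (1 - t))` towards the two terminals, it must
  -- balance the pull `ε * D`.
  let s' : ℝ → ℕ → ℝ := fun ε m => s m - ε * r m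
  let γ : ℝ → ℕ → ℝ := fun ε m => ε * D m * (t m * (1 - t m)) / s' ε m
  let q : ℝ → ℕ → Vec d := fun ε m => a m + γ ε m • (P m - a m)
  have hs' : ∀ m, Filter.Tendsto (fun ε => s' ε m) (nhdsWithin 0 (Set.Ioi 0)) (nhds (s m)) := by
    intro m
    have : Continuous fun ε => s' ε m := by fun_prop
    have h := this.tendsto 0
    simp only [s', zero_mul, sub_zero] at h
    exact h.mono_left nhdsWithin_le_nhds
  have hγ : ∀ m, Filter.Tendsto (fun ε => γ ε m) (nhdsWithin 0 (Set.Ioi 0)) (nhds 0) := by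
    intro m
    have : Continuous fun ε : ℝ => ε * D m * (t m * (1 - t m)) := by fun_prop
    have h := this.tendsto 0
    simp only [zero_mul] at h
    have h2 := (h.mono_left nhdsWithin_le_nhds).div (hs' m) (hs m).ne'
    rw [zero_div] at h2
    exact h2
  have hq : ∀ m, Filter.Tendsto (fun ε => q ε m) (nhdsWithin 0 (Set.Ioi 0)) (nhds (a m)) := by
    intro m
    simpa using ((hγ m).smul_const (P m - a m)).const_add (a m)
  have hinj₀ : Function.Injective
      (Sum.elim X (Sum.elim (fun m : Fin n => a m) fun m : Fin n => P m)) := by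
    refine hX.sumElim (Function.Injective.sumElim ?_ ?_ ?_) ?_
    · exact fun m k h => Fin.ext (hstr.anchor_inj m m.2 k k.2 h)
    · exact fun m k h => Fin.ext (hstr.node_inj m m.2 k k.2 h)
    · exact fun m k => hstr.anchor_ne m m.2 k k.2
    · rintro i (m | m) h
      · exact hstr.anchor_notMem m m.2 ⟨i, h⟩
      · exact hstr.node_notMem m m.2 ⟨i, h⟩
  have hev : ∀ᶠ ε in nhdsWithin (0 : ℝ) (Set.Ioi 0), (∀ m : Fin n, 0 < s' ε m ∧ γ ε m < 1) ∧
      Function.Injective (Sum.elim X (Sum.elim (fun m : Fin n => q ε m) fun m : Fin n => P m)) := by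
    refine (Filter.eventually_all.2 fun m : Fin n => ?_).and (eventually_injective hinj₀ ?_)
    · exact ((hs' m).eventually (lt_mem_nhds (hs m))).and
        ((hγ m).eventually (gt_mem_nhds one_pos))
    · rintro (i | m | m)
      · exact tendsto_const_nhds
      · exact hq m
      · exact tendsto_const_nhds
  obtain ⟨ε, ⟨hε₁, hinj⟩, hε⟩ := (hev.and self_mem_nhdsWithin).exists
  replace hε : 0 < ε := hε
  have hs₀ : ∀ m < n, 0 < s' ε m := fun m hm => (hε₁ ⟨m, hm⟩).1
  have hγ₁ : ∀ m < n, 0 < 1 - γ ε m := fun m hm => sub_pos.2 (hε₁ ⟨m, hm⟩).2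
  have ht₀ : ∀ m < n, 0 < t m := hstr.param_pos
  have ht₁ : ∀ m < n, 0 < 1 - t m := fun m hm => sub_pos.2 (hstr.param_lt m hm)
  have hgγ : ∀ m < n, s' ε m / (t m * (1 - t m)) * γ ε m = ε * D m := fun m hm => by
    have h1 := (hs₀ m hm).ne'
    have h2 := (ht₀ m hm).ne'
    have h3 := (ht₁ m hm).ne'
    simp only [γ]
    field_simp
  have hu : ∀ m < n, X (idx m).1 - q ε m
      = -(t m • (X (idx m).2 - X (idx m).1)) - γ ε m • (P m - a m) := fun m hm => by
    have h1 := hstr.anchor_eq m hm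
    have h2 : q ε m = (X (idx m).1 + t m • (X (idx m).2 - X (idx m).1)) + γ ε m • (P m - a m) := by
      rw [← h1]
    rw [h2]; module
  have hv : ∀ m < n, X (idx m).2 - q ε m
      = (1 - t m) • (X (idx m).2 - X (idx m).1) - γ ε m • (P m - a m) := fun m hm => by
    have : X (idx m).2 - q ε m = (X (idx m).2 - X (idx m).1) + (X (idx m).1 - q ε m) := by abel
    rw [this, hu m hm]; module
  have hPq : ∀ m, P m - q ε m = (1 - γ ε m) • (P m - a m) := fun m => by
    simp only [q]; module
  -- The shares `1 - t` and `t` aim the resultant of the terminal bars at `a m`; the division by `t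
  -- * (1 - t)` makes them act like a straight bar of density `s'` plus the shared pull. The factor
  -- `1 / (1 - γ)` in `B` offsets the shortening of the bar from `P m` to `q`.
  refine exists_uniloadable_stringWeb hn hidx (α := α) (β := β) (q := q ε) (P := P)
    (g₁ := fun m => s' ε m / (t m * (1 - t m)) * (1 - t m))
    (g₂ := fun m => s' ε m / (t m * (1 - t m)) * t m)
    (B := fun m => ε * D m / (1 - γ ε m)) (τ := fun m => ε * T m) ?_ ?_ ?_
    (fun m => mul_pos hε (hT m)) hinj hβ.symm ?_ ?_ ?_ ?_ ?_
  · exact fun m hm => mul_pos (div_pos (hs₀ m hm) (mul_pos (ht₀ m hm) (ht₁ m hm))) (ht₁ m hm)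
  · exact fun m hm => mul_pos (div_pos (hs₀ m hm) (mul_pos (ht₀ m hm) (ht₁ m hm))) (ht₀ m hm)
  · exact fun m hm => div_pos (mul_pos hε (hD m)) (hγ₁ m hm)
  · intro m hm
    set g := s' ε m / (t m * (1 - t m)) with hg
    have h1 : (ε * D m / (1 - γ ε m)) • (P m - q ε m) = (g * γ ε m) • (P m - a m) := by
      rw [hPq, smul_smul, div_mul_cancel₀ _ (hγ₁ m hm).ne', hgγ m hm]
    simp only [h1, hu m hm, hv m hm]
    module
  · intro m hm b c h
    rw [hPq, hu m hm] at h
    have h1 : (b * (1 - γ ε m) - c * γ ε m) • (P m - a m)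
        = (c * t m) • (X (idx m).2 - X (idx m).1) := by
      rw [← sub_eq_zero, ← h]; module
    -- `P m` is off the line of the segment, so both sides of `h1` vanish.
    have h2 : b * (1 - γ ε m) - c * γ ε m = 0 := by
      by_contra hne
      refine hstr.node_off m hm (t m + (b * (1 - γ ε m) - c * γ ε m)⁻¹ * (c * t m)) ?_
      rw [add_smul, mul_smul, ← h1, inv_smul_smul₀ hne, hstr.anchor_eq m hm]
      module
    rw [h2, zero_smul] at h1
    have hvu : X (idx m).2 - X (idx m).1 ≠ 0 := sub_ne_zero.2 fun h => hidx m (hX h).symm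
    have hc : c = 0 := by
      rcases mul_eq_zero.1 ((smul_eq_zero.1 h1.symm).resolve_right hvu) with h3 | h3
      · exact h3
      · exact absurd h3 (ht₀ m hm).ne'
    rw [hc, zero_mul, sub_zero] at h2
    exact ⟨(mul_eq_zero.1 h2).resolve_right (hγ₁ m hm).ne', hc⟩
  · intro m hm
    have h1 : (ε * D m / (1 - γ ε m)) • (q ε m - P m) = (ε * D m) • (a m - P m) := by
      rw [← neg_sub (P m), hPq, ← smul_neg, neg_sub, smul_smul, div_mul_cancel₀ _ (hγ₁ m hm).ne']
    have h2 := he m hm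
    simp only [h1]
    rw [← smul_zero ε, ← h2]
    module
  · intro m hm b c h
    have h1 : q ε m - P m = (1 - γ ε m) • (a m - P m) := by simp only [q]; module
    rw [h1] at h
    have hb : b = 0 := by
      by_contra hb
      refine hstr.rigid m hm (-(b⁻¹ * (c * (1 - γ ε m)))) ?_
      have : b • (P (m + 1) - P m) = -((c * (1 - γ ε m)) • (a m - P m)) := by
        rw [eq_neg_iff_add_eq_zero, ← h]; module
      rw [neg_smul, mul_smul, ← smul_neg, ← this, inv_smul_smul₀ hb]
    rw [hb, zero_smul, zero_add, smul_smul] at h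
    have hne : a m - P m ≠ 0 := sub_ne_zero.2 (hstr.anchor_ne m hm m hm)
    exact ⟨hb, (mul_eq_zero.1 ((smul_eq_zero.1 h).resolve_right hne)).resolve_right
      (hγ₁ m hm).ne'⟩
  -- The terminal forces of a linking node split exactly, not just to first order in `ε`, into a
  -- straight bar of density `s'` and the transferred pull of the string.
  · have h1 : ∀ m ∈ Finset.range n,
        (Pi.single (idx m).1 ((s' ε m / (t m * (1 - t m)) * (1 - t m)) • (q ε m - X (idx m).1))
          + Pi.single (idx m).2 ((s' ε m / (t m * (1 - t m)) * t m) • (q ε m - X (idx m).2))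
            : Fin N → Vec d)
        = ε • (Pi.single (idx m).1 (((1 - t m) * D m) • (P m - a m))
          + Pi.single (idx m).2 ((t m * D m) • (P m - a m)))
          - s' ε m • pairLoading X (idx m) := by
      intro m hm
      have hm := Finset.mem_range.1 hm
      have hg : s' ε m / (t m * (1 - t m)) * (t m * (1 - t m)) = s' ε m :=
        div_mul_cancel₀ _ (mul_pos (ht₀ m hm) (ht₁ m hm)).ne'
      have hgγ := hgγ m hm
      set g := s' ε m / (t m * (1 - t m))
      have e1 : (g * (1 - t m)) • (q ε m - X (idx m).1) = ε • (((1 - t m) * D m) • (P m - a m))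
          - s' ε m • (X (idx m).1 - X (idx m).2) := by
        rw [← neg_sub (X (idx m).1) (q ε m), hu m hm, ← hg]
        have : (ε • (((1 - t m) * D m) • (P m - a m)) : Vec d)
            = ((1 - t m) * (g * γ ε m)) • (P m - a m) := by rw [hgγ, smul_smul]; congr 1; ring
        rw [this]; module
      have e2 : (g * t m) • (q ε m - X (idx m).2) = ε • ((t m * D m) • (P m - a m))
          - s' ε m • (X (idx m).2 - X (idx m).1) := by
        rw [← neg_sub (X (idx m).2) (q ε m), hv m hm, ← hg]
        have : (ε • ((t m * D m) • (P m - a m)) : Vec d)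
            = (t m * (g * γ ε m)) • (P m - a m) := by rw [hgγ, smul_smul]; congr 1; ring
        rw [this]; module
      rw [e1, e2]
      simp only [pairLoading, Pi.single_sub, Pi.single_smul]
      module
    rw [Finset.sum_congr rfl h1, Finset.sum_sub_distrib, ← Finset.smul_sum]
    have h2 : ∑ m ∈ Finset.range n, s' ε m • pairLoading X (idx m)
        = ∑ m ∈ Finset.range n, s m • pairLoading X (idx m)
          - ε • stringLoading X n idx α β t T D a P := by
      rw [hr, Finset.smul_sum, ← Finset.sum_sub_distrib]
      refine Finset.sum_congr rfl fun m _ => ?_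
      rw [sub_smul, mul_smul]
    rw [h2, stringLoading]
    simp only [Pi.single_smul]
    module

/-! ### At most two terminals, and conclusion -/

/-- Without pairs the loading is zero, and so is all that a web without bars supports. -/
theorem exists_uniloadable_of_isEmpty {d N : ℕ} [IsEmpty (TerminalPair N)] {X : Fin N → Vec d}
    (hX : Function.Injective X) (s : TerminalPair N → ℝ) :
    ∃ W : FiniteWeb X, W.supportedLoadings = {G | ∃ c : ℝ, 0 ≤ c ∧
      G = c • ∑ p, s p • pairLoading X p.1} := by
  let W : FiniteWeb X :=
    ⟨0, Fin.elim0, hX.sumElim (fun i => i.elim0) fun _ i => i.elim0, ⊥⟩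
  have hforce : ∀ σ v, W.barForce σ v = 0 := fun σ v => by
    classical
    unfold FiniteWeb.barForce
    refine Finset.sum_eq_zero fun w hw => ?_
    simp only [Finset.mem_filter] at hw
    exact absurd hw.2 id
  refine ⟨W, Set.ext fun G => ⟨?_, ?_⟩⟩
  · rintro ⟨σ, hσ⟩
    refine ⟨0, le_rfl, funext fun i => ?_⟩
    have := hσ.terminal_equilibrium i
    rw [hforce, add_zero] at this
    simp [this]
  · rintro ⟨c, -, rfl⟩
    exact ⟨0, fun _ _ => le_rfl, fun i => by simp [hforce], fun k => k.elim0⟩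

/-- Two terminals are collinear, so no string in general position exists; the single bar joining
them suffices. -/
theorem exists_uniloadable_two {d : ℕ} {X : Fin 2 → Vec d}
    (hX : Function.Injective X) {s : TerminalPair 2 → ℝ} (hs : ∀ p, 0 < s p) :
    ∃ W : FiniteWeb X, W.supportedLoadings = {G | ∃ c : ℝ, 0 ≤ c ∧
      G = c • ∑ p, s p • pairLoading X p.1} := by
  classical
  let W : FiniteWeb X :=
    ⟨0, Fin.elim0, hX.sumElim (fun i => i.elim0) fun _ i => i.elim0, ⊤⟩
  let p₀ : TerminalPair 2 := ⟨(0, 1), by simp⟩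
  have hsum : ∑ p, s p • pairLoading X p.1 = s p₀ • pairLoading X p₀.1 := by
    refine Fintype.sum_eq_single p₀ fun p hp => absurd (Subtype.ext ?_) hp
    obtain ⟨⟨i, j⟩, hij⟩ := p
    simp only at hij
    exact Prod.ext (by simp only [p₀]; omega) (by simp only [p₀]; omega)
  rw [hsum]
  have hp0 : pairLoading X p₀.1 0 = -(X 1 - X 0) := by simp [pairLoading, p₀]
  have hp1 : pairLoading X p₀.1 1 = X 1 - X 0 := by simp [pairLoading, p₀]
  set e : Sym2 (Fin 2 ⊕ Fin 0) := s(.inl 0, .inl 1) with he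
  have hnorm : 0 < ‖X 1 - X 0‖ :=
    norm_pos_iff.2 (sub_ne_zero.2 fun h => one_ne_zero (hX h))
  have hforce : ∀ (σ : Sym2 (Fin 2 ⊕ Fin 0) → ℝ) v, W.barForce σ v = ∑ w : Fin 2 ⊕ Fin 0,
      if v ≠ w then (σ s(v, w) / ‖W.node w - W.node v‖) • (W.node w - W.node v) else 0 := by
    intro σ v
    unfold FiniteWeb.barForce
    rw [Finset.sum_filter]
    refine Finset.sum_congr rfl fun w _ => ?_
    by_cases h : v = w
    · have h' : ¬ W.bars.Adj v w := fun h' => h' h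
      rw [if_neg (not_not.2 h), if_neg h']
    · rw [if_pos h, if_pos (show W.bars.Adj v w from h)]
  have hf0 : ∀ σ : Sym2 (Fin 2 ⊕ Fin 0) → ℝ,
      W.barForce σ (.inl 0) = (σ e / ‖X 1 - X 0‖) • (X 1 - X 0) := by
    intro σ
    rw [hforce, Fintype.sum_sum_type, Fin.sum_univ_two]
    simp [FiniteWeb.node, he]
  have hf1 : ∀ σ : Sym2 (Fin 2 ⊕ Fin 0) → ℝ,
      W.barForce σ (.inl 1) = -((σ e / ‖X 1 - X 0‖) • (X 1 - X 0)) := by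
    intro σ
    have hswap : (s(.inl 1, .inl 0) : Sym2 (Fin 2 ⊕ Fin 0)) = e := Sym2.eq_swap
    rw [hforce, Fintype.sum_sum_type, Fin.sum_univ_two, ← smul_neg, neg_sub,
      norm_sub_rev (X 1)]
    simp [FiniteWeb.node, hswap]
  have hs₀ := hs p₀
  refine ⟨W, Set.ext fun G => ⟨?_, ?_⟩⟩
  · rintro ⟨σ, hσ⟩
    have hσe : 0 ≤ σ e := hσ.tension_nonneg e (by
      rw [he, SimpleGraph.mem_edgeSet]
      change (.inl 0 : Fin 2 ⊕ Fin 0) ≠ .inl 1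
      simp)
    refine ⟨σ e / ‖X 1 - X 0‖ / s p₀, by positivity, funext fun i => ?_⟩
    rw [smul_smul, div_mul_cancel₀ _ hs₀.ne', Pi.smul_apply]
    have h0 := hσ.terminal_equilibrium 0
    have h1 := hσ.terminal_equilibrium 1
    rw [hf0] at h0
    rw [hf1] at h1
    fin_cases i
    · change G 0 = _ • pairLoading X p₀.1 0
      rw [hp0, smul_neg]
      exact eq_neg_of_add_eq_zero_left h0
    · change G 1 = _ • pairLoading X p₀.1 1
      rw [hp1]
      exact add_neg_eq_zero.1 h1
  · rintro ⟨c, hc, rfl⟩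
    have hσ : c * s p₀ * ‖X 1 - X 0‖ / ‖X 1 - X 0‖ = c * s p₀ :=
      mul_div_cancel_right₀ _ hnorm.ne'
    refine ⟨fun _ => c * s p₀ * ‖X 1 - X 0‖, fun _ _ => by positivity, fun i => ?_,
      fun k => k.elim0⟩
    rw [smul_smul, Pi.smul_apply]
    fin_cases i
    · change (c * s p₀) • pairLoading X p₀.1 0 + W.barForce _ (.inl 0) = 0
      rw [hf0, hσ, hp0, smul_neg, neg_add_cancel]
    · change (c * s p₀) • pairLoading X p₀.1 1 + W.barForce _ (.inl 1) = 0
      rw [hf1, hσ, hp1, add_neg_cancel]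

theorem mainTheorem5 {d N : ℕ} (hd : 2 ≤ d) (X : Fin N → Vec d) (hX : Function.Injective X)
    (F : Fin N → Vec d) (hF : F ∈ interiorAdmissibleLoadingCone X) :
    ∃ W : FiniteWeb X, W.supportedLoadings = {G | ∃ c : ℝ, 0 ≤ c ∧ G = c • F} := by
  obtain ⟨F, hF, rfl⟩ := hF
  obtain ⟨s, hs, hsF⟩ := exists_pos_densities hF
  have hsurj := densityLoading_surjective hF
  rw [← hsF, densityLoading_coe]
  rcases le_or_gt N 2 with hN | hN
  · rcases hN.eq_or_lt with rfl | hN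
    · exact exists_uniloadable_two hX hs
    · have : IsEmpty (TerminalPair N) := ⟨fun p => by
        have := p.2
        omega⟩
      exact exists_uniloadable_of_isEmpty hX s
  let e := (Fintype.equivFin (TerminalPair N)).symm
  set n := Fintype.card (TerminalPair N) with hn
  let p₀ : TerminalPair N := ⟨(⟨0, by omega⟩, ⟨1, by omega⟩), by simp⟩
  let p₁ : TerminalPair N := ⟨(⟨0, by omega⟩, ⟨2, by omega⟩), by simp⟩
  have hn2 : 2 ≤ n := by
    have : Nontrivial (TerminalPair N) := ⟨p₀, p₁, by simp [p₀, p₁]⟩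
    exact Fintype.one_lt_card
  -- Strings are indexed by `ℕ`; beyond `n` any pair of distinct terminals will do.
  let ext : ℕ → TerminalPair N := fun m => if h : m < n then e ⟨m, h⟩ else p₀
  have hsum : ∀ f : TerminalPair N → ℝ, ∑ p, f p • pairLoading X p.1
      = ∑ m ∈ Finset.range n, f (ext m) • pairLoading X (ext m).1 := by
    intro f
    rw [← Fin.sum_univ_eq_sum_range (fun m => f (ext m) • pairLoading X (ext m).1),
      ← e.sum_comp]
    refine Finset.sum_congr rfl fun m _ => ?_
    simp only [ext, m.2, dite_true, Fin.eta]
  rw [hsum]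
  refine exists_uniloadable_of_densities hn2 hX
    (fun y w => exists_not_mem_line hd hN hX hsurj y w) (idx := fun m => (ext m).1)
    (fun m => (ext m).2.ne) (fun m => hs _) fun G hG => ?_
  obtain ⟨r, hr⟩ := hsurj ⟨G, hG⟩
  refine ⟨fun m => r (ext m), ?_⟩
  rw [← hsum, ← densityLoading_coe, hr]
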